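/- Let $(M,g,J,\omega)$ be a Kähler manifold of real dimension $2m$ with Levi-Civita connection $\nabla$ and Kähler form $\omega=g(J\cdot,\cdot)$. Let $\psi$ be a Hamiltonian $2$-form, i.e. a real $2$-form of type $(1,1)$ such that, for a smooth real function $\sigma$, $$\nabla_X\psi=\tfrac12\bigl(d\sigma\wedge J X^*-J d\sigma\wedge X^*\bigr)\qquad\text{for all vector fields }X ,$$ where $X^*=g(X,\cdot)$, $J\alpha=-\alpha\circ J$ on $1$-forms and $\alpha\wedge\beta=\alpha\otimes\beta-\beta\otimes\alpha$. (This forces $\sigma$ to be, up to a locally constant function, the trace $\mathrm{tr}_\omega\psi$.) Suppose that $\psi$ is non-degenerate with distinct eigenvalues, i.e. at every point the endomorphism $A$ of $TM$ with $\psi(v,w)=g(v,Aw)$ has $2m$ distinct complex eigenvalues. Then the eigenvalues of $A$ are $\pm i a_1,\dots,\pm i a_m$ for smooth real functions $0<a_1<\dots<a_m$ on $M$. For each of the $2^m$ choices of one eigenvalue out of each pair $\pm i a_\mu$, let $D\subset T_{\mathbb C}M$ be spanned by the corresponding eigenvectors. Each $D$ is a smooth distribution of rank $m$, is maximal isotropic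 for $g$ (extended complex-bilinearly), and is integrable, $[D,D]\subset D$. The $2^m$ distributions are pairwise distinct at every point, and they define $2^m$ complex structures $J_D$ (integrable almost complex structures, with vanishing Nijenhuis tensor), with respect to which $g$ is Hermitian, $D$ being the bundle $T^{1,0}$ of $J_D$; the $J_D$ are pairwise distinct at every point. Moreover $\varphi=\psi-\tfrac12\sigma\omega$ is a conformal Killing–Yano tensor, i.e. with $n=2m$ there are a $3$-form $\tau$ and a $1$-form $K$ such that $\nabla_X\varphi=\tfrac13 X\lrcorner\tau+\tfrac1{n-1}X^*\wedge K$ for all $X$. Every eigenvector of $\psi$ is an eigenvector of $\varphi$, so that the distributions $D$ are also spanned by eigenvectors of $\varphi$; and if $m\ge2$, then $\varphi$ is closed if and only if it is parallel. -/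

import Mathlib

open Bundle VectorField Module
open scoped Manifold ContDiff Bundle TensorProduct

set_option linter.unusedSectionVars false

noncomputable section

namespace HamiltonianForms

variable {E : Type*} [NormedAddCommGroup E] [NormedSpace ℝ E]
  {M : Type*} [TopologicalSpace M] [ChartedSpace E M]

/-! ### Real tensor fields -/

variable (E M) in
/-- Real vector fields on `M` (no regularity). -/
abbrev VField : Type _ := Π x : M, TangentSpace 𝓘(ℝ, E) x

variable (E M) in
/-- Fields of endomorphisms of the tangent spaces (no regularity). -/
abbrev EndField : Type _ :=
  Π x : M, TangentSpace 𝓘(ℝ, E) x →L[ℝ] TangentSpace 𝓘(ℝ, E) x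

variable (E M) in
/-- Fields of bilinear forms on the tangent spaces (no regularity). -/
abbrev BilinField : Type _ :=
  Π x : M, TangentSpace 𝓘(ℝ, E) x →L[ℝ] TangentSpace 𝓘(ℝ, E) x →L[ℝ] ℝ

/-- The vector field `J X`. -/
def EndField.app (J : EndField E M) (X : VField E M) : VField E M := fun x => J x (X x)

/-- A field of endomorphisms is a smooth section of `End(TM)`. -/
def IsSmoothEnd [IsManifold 𝓘(ℝ, E) ∞ M] (J : EndField E M) : Prop :=
  ContMDiff 𝓘(ℝ, E) (𝓘(ℝ, E).prod 𝓘(ℝ, E →L[ℝ] E)) ∞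
    (fun x => TotalSpace.mk' (E →L[ℝ] E)
      (E := fun x : M => TangentSpace 𝓘(ℝ, E) x →L[ℝ] TangentSpace 𝓘(ℝ, E) x) x (J x))

/-- A smooth differential `2`-form. -/
structure IsTwoForm [IsManifold 𝓘(ℝ, E) ∞ M] (β : BilinField E M) : Prop where
  smooth : ContMDiff 𝓘(ℝ, E) (𝓘(ℝ, E).prod 𝓘(ℝ, E →L[ℝ] E →L[ℝ] ℝ)) ∞
    (fun x => TotalSpace.mk' (E →L[ℝ] E →L[ℝ] ℝ)
      (E := fun x : M => TangentSpace 𝓘(ℝ, E) x →L[ℝ] TangentSpace 𝓘(ℝ, E) x →L[ℝ] ℝ) x (β x))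
  alt : ∀ x v, β x v v = 0

/-- The exterior derivative of a `2`-form evaluated on vector fields:
`dβ(X,Y,Z) = X β(Y,Z) - Y β(X,Z) + Z β(X,Y) - β([X,Y],Z) + β([X,Z],Y) - β([Y,Z],X)`. -/
def extDeriv₂ (β : BilinField E M) (X Y Z : VField E M) (x : M) : ℝ :=
  mvfderiv 𝓘(ℝ, E) (fun y => β y (Y y) (Z y)) x (X x)
    - mvfderiv 𝓘(ℝ, E) (fun y => β y (X y) (Z y)) x (Y x)
    + mvfderiv 𝓘(ℝ, E) (fun y => β y (X y) (Y y)) x (Z x)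
    - β x (mlieBracket 𝓘(ℝ, E) X Y x) (Z x)
    + β x (mlieBracket 𝓘(ℝ, E) X Z x) (Y x)
    - β x (mlieBracket 𝓘(ℝ, E) Y Z x) (X x)

/-- A `2`-form is closed. -/
def IsClosedForm [IsManifold 𝓘(ℝ, E) ∞ M] (β : BilinField E M) : Prop :=
  ∀ (x : M) (X Y Z : VField E M), MDiffAt (T% X) x → MDiffAt (T% Y) x → MDiffAt (T% Z) x →
    extDeriv₂ β X Y Z x = 0

/-- The covariant derivative of a bilinear form evaluated on vector fields:
`(∇_v β)(Y,Z) = v (β(Y,Z)) - β(∇_v Y, Z) - β(Y, ∇_v Z)` for a tangent vector `v` at `x`. -/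
def covDeriv₂ [IsManifold 𝓘(ℝ, E) ∞ M]
    (cov : CovariantDerivative 𝓘(ℝ, E) E (fun x : M => TangentSpace 𝓘(ℝ, E) x))
    (β : BilinField E M) (x : M) (v : TangentSpace 𝓘(ℝ, E) x) (Y Z : VField E M) : ℝ :=
  mvfderiv 𝓘(ℝ, E) (fun y => β y (Y y) (Z y)) x v
    - β x (cov Y x v) (Z x) - β x (Y x) (cov Z x v)

/-- A bilinear form is parallel. -/
def IsParallelForm [IsManifold 𝓘(ℝ, E) ∞ M]
    (cov : CovariantDerivative 𝓘(ℝ, E) E (fun x : M => TangentSpace 𝓘(ℝ, E) x))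
    (β : BilinField E M) : Prop :=
  ∀ (x : M) (v : TangentSpace 𝓘(ℝ, E) x) (Y Z : VField E M),
    MDiffAt (T% Y) x → MDiffAt (T% Z) x → covDeriv₂ cov β x v Y Z = 0

/-! ### Complex structures -/

/-- A complex structure, as an integrable almost complex structure: a smooth `J` with `J² = -1`
and vanishing Nijenhuis tensor `[JX,JY] - J[JX,Y] - J[X,JY] - [X,Y]`. -/
structure IsComplexStructure [IsManifold 𝓘(ℝ, E) ∞ M] (J : EndField E M) : Prop where
  smooth : IsSmoothEnd J
  sq : ∀ x v, J x (J x v) = -v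
  integrable : ∀ (x : M) (X Y : VField E M), MDiffAt (T% X) x → MDiffAt (T% Y) x →
    mlieBracket 𝓘(ℝ, E) (J.app X) (J.app Y) x
      - J x (mlieBracket 𝓘(ℝ, E) (J.app X) Y x)
      - J x (mlieBracket 𝓘(ℝ, E) X (J.app Y) x)
      - mlieBracket 𝓘(ℝ, E) X Y x = 0

/-! ### Complex vector fields and complex distributions -/

variable (E M) in
/-- A complex distribution: a complex subspace of each complexified tangent space. -/
abbrev CDistribution : Type _ :=
  Π x : M, Submodule ℂ (ℂ ⊗[ℝ] TangentSpace 𝓘(ℝ, E) x)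

/-- The complex tangent vector `v + i w`. -/
def cvec {x : M} (v w : TangentSpace 𝓘(ℝ, E) x) : ℂ ⊗[ℝ] TangentSpace 𝓘(ℝ, E) x :=
  (1 : ℂ) ⊗ₜ[ℝ] v + Complex.I ⊗ₜ[ℝ] w

/-- The complex-linear extension of an endomorphism of a tangent space. -/
def cEnd {x : M} (A : TangentSpace 𝓘(ℝ, E) x →L[ℝ] TangentSpace 𝓘(ℝ, E) x) :
    Module.End ℂ (ℂ ⊗[ℝ] TangentSpace 𝓘(ℝ, E) x) :=
  (A : TangentSpace 𝓘(ℝ, E) x →ₗ[ℝ] TangentSpace 𝓘(ℝ, E) x).baseChange ℂ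

/-- `D` is a smooth complex vector subbundle of rank `r` of the complexified tangent bundle: near
each point it is spanned by `r` smooth complex vector fields `X j + i Y j` that are pointwise
linearly independent over `ℂ`. -/
def IsSmoothOfRank [IsManifold 𝓘(ℝ, E) ∞ M] (D : CDistribution E M) (r : ℕ) : Prop :=
  ∀ x₀ : M, ∃ U : Set M, IsOpen U ∧ x₀ ∈ U ∧ ∃ X Y : Fin r → VField E M,
    (∀ j, CMDiff[U] ∞ (T% (X j)) ∧ CMDiff[U] ∞ (T% (Y j))) ∧
    ∀ x ∈ U, LinearIndependent ℂ (fun j => cvec (X j x) (Y j x)) ∧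
      Submodule.span ℂ (Set.range fun j => cvec (X j x) (Y j x)) = D x

/-- Frobenius integrability `[D, D] ⊆ D`: the bracket
`[X + iY, X' + iY'] = ([X,X'] - [Y,Y']) + i ([X,Y'] + [Y,X'])` of any two smooth local sections of
`D`, on any open set, is a section of `D`. -/
def IsInvolutive [IsManifold 𝓘(ℝ, E) ∞ M] (D : CDistribution E M) : Prop :=
  ∀ (U : Set M), IsOpen U → ∀ X Y X' Y' : VField E M,
    CMDiff[U] ∞ (T% X) → CMDiff[U] ∞ (T% Y) → CMDiff[U] ∞ (T% X') → CMDiff[U] ∞ (T% Y') →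
    (∀ x ∈ U, cvec (X x) (Y x) ∈ D x) → (∀ x ∈ U, cvec (X' x) (Y' x) ∈ D x) →
    ∀ x ∈ U,
      cvec (mlieBracket 𝓘(ℝ, E) X X' x - mlieBracket 𝓘(ℝ, E) Y Y' x)
        (mlieBracket 𝓘(ℝ, E) X Y' x + mlieBracket 𝓘(ℝ, E) Y X' x) ∈ D x

/-! ### Riemannian notions -/

section Riemannian

variable [FiniteDimensional ℝ E] [IsManifold 𝓘(ℝ, E) ∞ M]
  [RiemannianBundle (fun x : M => TangentSpace 𝓘(ℝ, E) x)]

instance (x : M) : FiniteDimensional ℝ (TangentSpace 𝓘(ℝ, E) x) :=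
  inferInstanceAs (FiniteDimensional ℝ E)

/-- The endomorphism `A` obtained from a bilinear form `β` by raising an index with the metric:
`g(v, A w) = β(v, w)`. -/
def sharp (β : BilinField E M) : EndField E M := fun x =>
  InnerProductSpace.continuousLinearMapOfBilin (𝕜 := ℝ) (β x).flip

lemma inner_sharp (β : BilinField E M) (x : M) (v w : TangentSpace 𝓘(ℝ, E) x) :
    inner ℝ v (sharp β x w) = β x v w := by
  rw [real_inner_comm]
  exact InnerProductSpace.continuousLinearMapOfBilin_apply _ w v

/-- The metric vanishes on `D`, where the metric is extended complex-bilinearly. -/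
def IsIsotropic (D : CDistribution E M) : Prop :=
  ∀ x, ∀ v ∈ D x, ∀ w ∈ D x,
    LinearMap.BilinForm.baseChange ℂ (innerₗ (TangentSpace 𝓘(ℝ, E) x)) v w = 0

/-- `J` is orthogonal for the metric. -/
def IsOrthogonalEnd (J : EndField E M) : Prop :=
  ∀ x (v w : TangentSpace 𝓘(ℝ, E) x), inner ℝ (J x v) (J x w) = (inner ℝ v w : ℝ)

/-- The form `ω(v, w) = g(J v, w)`. -/
def fundForm (J : EndField E M) : BilinField E M := fun x =>
  ContinuousLinearMap.comp (innerSL ℝ) (J x)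

lemma fundForm_apply (J : EndField E M) (x : M) (v w : TangentSpace 𝓘(ℝ, E) x) :
    fundForm J x v w = inner ℝ (J x v) w := rfl

/-- `(g, J)` is a Kähler structure: `J` is a complex structure, `g` is Hermitian, and the
Kähler form `ω = g(J·,·)` is closed. -/
structure IsKaehler (J : EndField E M) : Prop where
  complex : IsComplexStructure J
  hermitian : IsOrthogonalEnd J
  closed : IsClosedForm (fundForm J)

/-- `cov` is the Levi-Civita connection: it is compatible with the metric and torsion-free. -/
structure IsLeviCivita
    (cov : CovariantDerivative 𝓘(ℝ, E) E (fun x : M => TangentSpace 𝓘(ℝ, E) x)) : Prop where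
  metric : ∀ (x : M) (v : TangentSpace 𝓘(ℝ, E) x) (Y Z : VField E M),
    MDiffAt (T% Y) x → MDiffAt (T% Z) x →
    mvfderiv 𝓘(ℝ, E) (fun y => (inner ℝ (Y y) (Z y) : ℝ)) x v =
      inner ℝ (cov Y x v) (Z x) + inner ℝ (Y x) (cov Z x v)
  torsion : cov.torsion = 0

/-- `ψ` is a Hamiltonian `2`-form with associated smooth function `σ`: `ψ` is a `2`-form of type
`(1,1)`, and `∇_v ψ = ½ (dσ ∧ J v* - J dσ ∧ v*)` for all tangent vectors `v`. Here
`J α = - α ∘ J` on `1`-forms, so that `J v* = (J v)*`, and `α ∧ β = α ⊗ β - β ⊗ α`. -/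
structure IsHamiltonian
    (cov : CovariantDerivative 𝓘(ℝ, E) E (fun x : M => TangentSpace 𝓘(ℝ, E) x))
    (J : EndField E M) (ψ : BilinField E M) (σ : M → ℝ) : Prop where
  form : IsTwoForm ψ
  oneOne : ∀ x v w, ψ x (J x v) (J x w) = ψ x v w
  smooth : ContMDiff 𝓘(ℝ, E) 𝓘(ℝ, ℝ) ∞ σ
  eqn : ∀ (x : M) (v : TangentSpace 𝓘(ℝ, E) x) (Y Z : VField E M),
    MDiffAt (T% Y) x → MDiffAt (T% Z) x →
    covDeriv₂ cov ψ x v Y Z =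
      1 / 2 * (
        (mvfderiv 𝓘(ℝ, E) σ x (Y x) * inner ℝ (J x v) (Z x)
          - mvfderiv 𝓘(ℝ, E) σ x (Z x) * inner ℝ (J x v) (Y x))
        - ((-mvfderiv 𝓘(ℝ, E) σ x (J x (Y x))) * inner ℝ v (Z x)
          - (-mvfderiv 𝓘(ℝ, E) σ x (J x (Z x))) * inner ℝ v (Y x)))

/-- Non-degeneracy of a bilinear form, at every point. -/
def IsNondegenerate (β : BilinField E M) : Prop :=
  ∀ x v, (∀ w, β x v w = 0) → v = 0

/-- At every point the endomorphism obtained by raising an index has as many distinct complex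
eigenvalues as the dimension of `M`. -/
def HasDistinctEigenvalues (β : BilinField E M) : Prop :=
  ∀ x, {z : ℂ | (cEnd (sharp β x)).HasEigenvalue z}.ncard = finrank ℝ E

/-- `φ` is a conformal Killing `2`-form (conformal Killing-Yano tensor) on a manifold of
dimension `n`: a `2`-form with `∇_v φ = ⅓ v ⌟ τ + 1/(n-1) v* ∧ K` for a `3`-form `τ` and a
`1`-form `K`. -/
def IsConformalKilling
    (cov : CovariantDerivative 𝓘(ℝ, E) E (fun x : M => TangentSpace 𝓘(ℝ, E) x))
    (φ : BilinField E M) : Prop :=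
  IsTwoForm φ ∧
  ∃ (τ : Π x : M, (TangentSpace 𝓘(ℝ, E) x) [⋀^Fin 3]→ₗ[ℝ] ℝ)
    (K : Π x : M, TangentSpace 𝓘(ℝ, E) x →L[ℝ] ℝ),
    ∀ (x : M) (v : TangentSpace 𝓘(ℝ, E) x) (Y Z : VField E M),
      MDiffAt (T% Y) x → MDiffAt (T% Z) x →
      covDeriv₂ cov φ x v Y Z =
        1 / 3 * τ x ![v, Y x, Z x]
          + 1 / ((finrank ℝ E : ℝ) - 1) * (inner ℝ v (Y x) * K x (Z x) - inner ℝ v (Z x) * K x (Y x))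

/-- The form `ψ - ½ σ ω`. -/
def shiftedForm (J : EndField E M) (ψ : BilinField E M) (σ : M → ℝ) : BilinField E M :=
  fun x => ψ x - (σ x / 2) • fundForm J x

/-- The distribution spanned, at each point, by one eigenvector from each pair of eigenvalues
`± i a μ` of the endomorphism of `β`; the sign in the `μ`-th pair is chosen by `s μ`. -/
def eigenDistribution {m : ℕ} (β : BilinField E M) (a : Fin m → M → ℝ) (s : Fin m → Bool) :
    CDistribution E M := fun x =>
  ⨆ μ : Fin m, Module.End.eigenspace (cEnd (sharp β x))
    (if s μ then (a μ x : ℂ) * Complex.I else -((a μ x : ℂ) * Complex.I))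

/-- The bundle `T^{1,0}` of `J`: the `i`-eigenspaces in the complexified tangent spaces. -/
def holTangent (J : EndField E M) : CDistribution E M := fun x =>
  Module.End.eigenspace (cEnd (J x)) Complex.I

end Riemannian

end HamiltonianForms

end

namespace HamiltonianForms

/-! ### Complexified vectors in real terms, and real polynomials acting on eigenvectors. -/

section Complexification

variable {V : Type*} [AddCommGroup V] [Module ℝ V]

/-! The endomorphism `A = sharp ψ` is skew and injective with `2m` distinct eigenvalues, so these
are `± i a μ` with `0 < a 0 < a 1 < ...`, each of them simple, and the complexified tangent space
has an eigenbasis (`exists_eigenvalue_pairs`, `exists_isEigenbasis`). The implicit function theorem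
applied to the characteristic polynomial makes the `a μ` smooth (`contMDiff_eigenvalue`).

Eigenvectors are never differentiated. For each choice of signs `s`, interpolation gives a real
polynomial, with smooth coefficients, equal to `i` at the selected eigenvalues and `-i` at the
others. Its value `S` at `A` is a smooth real endomorphism whose `i`-eigenspace is the distribution
`D` (`eigenspace_structPoly`). Identities between polynomials in `A` can be checked on the spectrum
(`aeval_eq`): `S² = -1`, and `S` is orthogonal because its polynomial is odd on the spectrum.
Orthogonality makes `D` isotropic.

Integrability is `isComplexStructure_of_aeval`. Fix `v` and put `T = ∇_{Sv} S - S ∇_v S`.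
Differentiating `AS = SA` expresses the commutator of `T` and `A` through `∇A`, and the Hamiltonian
equation makes it vanish, since `S` is orthogonal and commutes with `J`. Hence `T` commutes with
`S`, a polynomial in `A`; but differentiating `S² = -1` shows that `T` anticommutes with `S`. So `T
= 0`, which for a torsion-free connection kills the Nijenhuis tensor, and `D = T^{1,0}` is then
involutive.

For `φ = ψ - ½ σ ω`, the Kähler condition gives `∇J = 0` (`covEnd_eq_zero`), so `∇φ` depends only on
`dσ`. The shift by `½ σ ω` completes the part `dσ ∧ Jv*` of `∇_v ψ` to a contraction of the `3`-form
`dσ ∧ ω`, and the rest has the form `v* ∧ K`. If `m ≥ 2` and `φ` is closed, then `dσ ∧ ω = 0` forces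
`dσ = 0`, hence `∇φ = 0`. -/

lemma exists_eq_one_tmul_add_I_tmul (z : ℂ ⊗[ℝ] V) :
    ∃ u w : V, z = (1 : ℂ) ⊗ₜ[ℝ] u + Complex.I ⊗ₜ[ℝ] w := by
  induction z using TensorProduct.induction_on with
  | zero => exact ⟨0, 0, by simp⟩
  | tmul c v =>
    refine ⟨c.re • v, c.im • v, ?_⟩
    rw [← TensorProduct.smul_tmul, ← TensorProduct.smul_tmul, ← TensorProduct.add_tmul]
    congr 1
    apply Complex.ext <;> simp
  | add x y hx hy =>
    obtain ⟨u, w, rfl⟩ := hx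
    obtain ⟨u', w', rfl⟩ := hy
    exact ⟨u + u', w + w', by simp only [TensorProduct.tmul_add]; abel⟩

lemma one_tmul_add_I_tmul_eq_zero {u w : V}
    (h : (1 : ℂ) ⊗ₜ[ℝ] u + Complex.I ⊗ₜ[ℝ] w = 0) : u = 0 ∧ w = 0 := by
  classical
  have h0 := congrArg (TensorProduct.equivFinsuppOfBasisLeft (N := V) Complex.basisOneI) h
  have h1 := DFunLike.congr_fun h0 0
  have h2 := DFunLike.congr_fun h0 1
  simp at h1 h2
  exact ⟨h1, h2⟩

lemma one_tmul_add_I_tmul_inj {u w u' w' : V}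
    (h : (1 : ℂ) ⊗ₜ[ℝ] u + Complex.I ⊗ₜ[ℝ] w = (1 : ℂ) ⊗ₜ[ℝ] u' + Complex.I ⊗ₜ[ℝ] w') :
    u = u' ∧ w = w' := by
  have := one_tmul_add_I_tmul_eq_zero (u := u - u') (w := w - w') (by
    rw [TensorProduct.tmul_sub, TensorProduct.tmul_sub, ← sub_eq_zero.mpr h]; abel)
  exact ⟨sub_eq_zero.mp this.1, sub_eq_zero.mp this.2⟩

lemma smul_one_tmul_add_I_tmul (c : ℂ) (u w : V) :
    c • ((1 : ℂ) ⊗ₜ[ℝ] u + Complex.I ⊗ₜ[ℝ] w) =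
      (1 : ℂ) ⊗ₜ[ℝ] (c.re • u - c.im • w) + Complex.I ⊗ₜ[ℝ] (c.re • w + c.im • u) := by
  simp only [smul_add, TensorProduct.smul_tmul', smul_eq_mul, TensorProduct.tmul_add,
    TensorProduct.tmul_sub, ← TensorProduct.smul_tmul]
  have h1 : (c * 1) ⊗ₜ[ℝ] u = (c.re • (1:ℂ)) ⊗ₜ[ℝ] u + (c.im • Complex.I) ⊗ₜ[ℝ] u := by
    rw [← TensorProduct.add_tmul]; congr 1; apply Complex.ext <;> simp
  have h2 : (c * Complex.I) ⊗ₜ[ℝ] w = (c.re • Complex.I) ⊗ₜ[ℝ] w - (c.im • (1:ℂ)) ⊗ₜ[ℝ] w := by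
    rw [← TensorProduct.sub_tmul]; congr 1; apply Complex.ext <;> simp
  rw [h1, h2]; abel

/-- The eigenvector equation in real terms. -/
lemma baseChange_apply_eq_smul_iff (A : V →ₗ[ℝ] V) (c : ℂ) (u w : V) :
    A.baseChange ℂ ((1 : ℂ) ⊗ₜ[ℝ] u + Complex.I ⊗ₜ[ℝ] w) =
        c • ((1 : ℂ) ⊗ₜ[ℝ] u + Complex.I ⊗ₜ[ℝ] w) ↔
      A u = c.re • u - c.im • w ∧ A w = c.re • w + c.im • u := by
  rw [smul_one_tmul_add_I_tmul, map_add, LinearMap.baseChange_tmul, LinearMap.baseChange_tmul]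
  constructor
  · exact one_tmul_add_I_tmul_inj
  · rintro ⟨h1, h2⟩; rw [h1, h2]

lemma hasEigenvalue_baseChange_iff (A : V →ₗ[ℝ] V) (c : ℂ) :
    Module.End.HasEigenvalue (A.baseChange ℂ) c ↔
      ∃ u w : V, ¬ (u = 0 ∧ w = 0) ∧ A u = c.re • u - c.im • w ∧ A w = c.re • w + c.im • u := by
  constructor
  · intro h
    obtain ⟨z, hz⟩ := h.exists_hasEigenvector
    obtain ⟨u, w, rfl⟩ := exists_eq_one_tmul_add_I_tmul z
    refine ⟨u, w, ?_, (baseChange_apply_eq_smul_iff A c u w).1 hz.apply_eq_smul⟩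
    rintro ⟨rfl, rfl⟩
    exact hz.2 (by simp)
  · rintro ⟨u, w, h0, h⟩
    refine Module.End.hasEigenvalue_of_hasEigenvector
      (x := (1 : ℂ) ⊗ₜ[ℝ] u + Complex.I ⊗ₜ[ℝ] w) ⟨?_, fun h => h0 (one_tmul_add_I_tmul_eq_zero h)⟩
    rw [Module.End.mem_eigenspace_iff]
    exact (baseChange_apply_eq_smul_iff A c u w).2 h

/-- Since `A` is real, conjugating an eigenvector `u + i w` to `u - i w` conjugates its eigenvalue.
-/
lemma hasEigenvalue_baseChange_conj {A : V →ₗ[ℝ] V} {c : ℂ}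
    (h : Module.End.HasEigenvalue (A.baseChange ℂ) c) :
    Module.End.HasEigenvalue (A.baseChange ℂ) (star c) := by
  rw [hasEigenvalue_baseChange_iff] at h ⊢
  obtain ⟨u, w, h0, h1, h2⟩ := h
  refine ⟨u, -w, by simpa using h0, ?_, ?_⟩
  · simp [h1]
  · simp [h2]; abel

lemma baseChange_aeval (A : Module.End ℝ V) (q : Polynomial ℝ) :
    (Polynomial.aeval A q : Module.End ℝ V).baseChange ℂ =
      Polynomial.aeval (A.baseChange ℂ : Module.End ℂ (ℂ ⊗[ℝ] V))
        (q.map (algebraMap ℝ ℂ)) := by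
  rw [Polynomial.aeval_map_algebraMap]
  exact (Polynomial.aeval_algHom_apply (Module.End.baseChangeHom ℝ ℂ V) A q).symm

lemma aeval_baseChange_apply {A : Module.End ℝ V} {c : ℂ} {z : ℂ ⊗[ℝ] V}
    (h : A.baseChange ℂ z = c • z) (q : Polynomial ℝ) :
    (Polynomial.aeval A q : Module.End ℝ V).baseChange ℂ z =
      (q.map (algebraMap ℝ ℂ)).eval c • z := by
  rcases eq_or_ne z 0 with rfl | hz
  · simp
  rw [baseChange_aeval]
  exact Module.End.aeval_apply_of_hasEigenvector
    ⟨Module.End.mem_eigenspace_iff.2 h, hz⟩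

end Complexification

/-- The eigenvalue `± i t`. -/
noncomputable def eigVal (t : ℝ) (s : Bool) : ℂ :=
  if s then (t : ℂ) * Complex.I else -((t : ℂ) * Complex.I)

lemma eigVal_eq (t : ℝ) (s : Bool) : eigVal t s = ((if s then t else -t : ℝ) : ℂ) * Complex.I := by
  cases s <;> simp [eigVal]

lemma eigVal_sq (t : ℝ) (s : Bool) : eigVal t s ^ 2 = ((-t ^ 2 : ℝ) : ℂ) := by
  rw [eigVal_eq, mul_pow, Complex.I_sq]; cases s <;> simp

lemma eigVal_inj {m : ℕ} {a : Fin m → ℝ} (ha : ∀ μ, 0 < a μ) (hinj : Function.Injective a) :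
    Function.Injective fun k : Fin m × Bool => eigVal (a k.1) k.2 := by
  rintro ⟨μ, s⟩ ⟨ν, t⟩ h
  simp only [eigVal_eq] at h
  have h := mul_right_cancel₀ Complex.I_ne_zero h
  rw [Complex.ofReal_inj] at h
  have h1 := ha μ
  have h2 := ha ν
  cases s <;> cases t <;> simp at h ⊢
  · exact hinj h
  · linarith
  · linarith
  · exact hinj h

/-! ### Eigenvalue pairs of an injective skew endomorphism. -/

section Pairs

variable {V : Type*} [NormedAddCommGroup V] [InnerProductSpace ℝ V] [FiniteDimensional ℝ V]

lemma re_eq_zero_of_hasEigenvalue {A : V →ₗ[ℝ] V}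
    (hskew : ∀ v w, inner ℝ (A v) w = -(inner ℝ v (A w) : ℝ)) {c : ℂ}
    (h : Module.End.HasEigenvalue (A.baseChange ℂ) c) : c.re = 0 := by
  obtain ⟨u, w, h0, h1, h2⟩ := (hasEigenvalue_baseChange_iff A c).1 h
  have hz : ∀ v, inner ℝ (A v) v = (0 : ℝ) := fun v => by
    have h1 := hskew v v
    have h2 := real_inner_comm (A v) v
    linarith
  have e1 := hz u
  have e2 := hz w
  rw [h1, inner_sub_left, real_inner_smul_left, real_inner_smul_left] at e1
  rw [h2, inner_add_left, real_inner_smul_left, real_inner_smul_left, real_inner_comm] at e2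
  -- Adding `⟨Au, u⟩ = 0` and `⟨Aw, w⟩ = 0` cancels the cross terms carrying `c.im`.
  have e3 : c.re * (inner ℝ u u + inner ℝ w w) = 0 := by
    rw [real_inner_comm w w] at e2
    rw [real_inner_comm w u] at e2
    linarith [real_inner_comm u w]
  rcases mul_eq_zero.1 e3 with h | h
  · exact h
  · exfalso; apply h0
    have p1 := real_inner_self_nonneg (x := u)
    have p2 := real_inner_self_nonneg (x := w)
    exact ⟨inner_self_eq_zero.1 (by linarith : inner ℝ u u = 0),
      inner_self_eq_zero.1 (by linarith : inner ℝ w w = 0)⟩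

lemma ne_zero_of_hasEigenvalue {A : V →ₗ[ℝ] V} (hA : ∀ v, A v = 0 → v = 0) {c : ℂ}
    (h : Module.End.HasEigenvalue (A.baseChange ℂ) c) : c ≠ 0 := by
  rintro rfl
  obtain ⟨u, w, h0, h1, h2⟩ := (hasEigenvalue_baseChange_iff A 0).1 h
  exact h0 ⟨hA u (by simpa using h1), hA w (by simpa using h2)⟩

/-- The eigenvalues of a skew injective endomorphism with distinct eigenvalues. -/
lemma exists_eigenvalue_pairs {m : ℕ} (hdim : finrank ℝ V = 2 * m) {A : V →ₗ[ℝ] V}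
    (hskew : ∀ v w, inner ℝ (A v) w = -(inner ℝ v (A w) : ℝ)) (hA : ∀ v, A v = 0 → v = 0)
    (hdist : {z : ℂ | Module.End.HasEigenvalue (A.baseChange ℂ) z}.ncard = finrank ℝ V) :
    ∃ a : Fin m → ℝ, (∀ μ, 0 < a μ) ∧ StrictMono a ∧
      ∀ z : ℂ, Module.End.HasEigenvalue (A.baseChange ℂ) z ↔ ∃ μ s, z = eigVal (a μ) s := by
  set L : Set ℂ := {z : ℂ | Module.End.HasEigenvalue (A.baseChange ℂ) z} with hL
  have hfin : L.Finite := Module.End.finite_hasEigenvalue _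
  set S : Set ℝ := {t : ℝ | 0 < t ∧ (t : ℂ) * Complex.I ∈ L} with hS
  have hi1 : Function.Injective fun t : ℝ => (t : ℂ) * Complex.I := fun s t h => by
    simpa using mul_right_cancel₀ Complex.I_ne_zero h
  have hi2 : Function.Injective fun t : ℝ => -((t : ℂ) * Complex.I) := fun s t h => hi1 (neg_inj.1 h)
  have hSfin : S.Finite := by
    apply Set.Finite.of_finite_image (f := fun t : ℝ => (t : ℂ) * Complex.I) _ hi1.injOn
    exact hfin.subset (by rintro _ ⟨t, ht, rfl⟩; exact ht.2)
  have hneg : ∀ t : ℝ, (t : ℂ) * Complex.I ∈ L → -((t : ℂ) * Complex.I) ∈ L := fun t ht => by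
    have h := hasEigenvalue_baseChange_conj ht
    have hs : star ((t : ℂ) * Complex.I) = -((t : ℂ) * Complex.I) := by simp
    rw [hs] at h
    exact h
  have hunion : L = (fun t : ℝ => (t : ℂ) * Complex.I) '' S ∪
      (fun t : ℝ => -((t : ℂ) * Complex.I)) '' S := by
    ext z
    constructor
    · intro hz
      have hre := re_eq_zero_of_hasEigenvalue hskew hz
      have hzz : z = (z.im : ℂ) * Complex.I := by apply Complex.ext <;> simp [hre]
      have hne : z.im ≠ 0 := fun h => ne_zero_of_hasEigenvalue hA hz (by rw [hzz, h]; simp)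
      rcases lt_or_gt_of_ne hne with h | h
      · right
        refine ⟨-z.im, ⟨by linarith, ?_⟩, ?_⟩
        · have := hneg z.im (hzz ▸ hz)
          simpa using this
        · rw [hzz]; simp
      · left
        exact ⟨z.im, ⟨h, hzz ▸ hz⟩, hzz.symm⟩
    · rintro (⟨t, ht, rfl⟩ | ⟨t, ht, rfl⟩)
      · exact ht.2
      · exact hneg t ht.2
  -- The eigenvalues split into disjoint copies of `S` on the two imaginary half-axes, so `2m` of
  -- them leave `m` positive numbers, which are then listed in increasing order.
  have hcard : S.ncard = m := by
    have h1 : L.ncard = S.ncard + S.ncard := by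
      rw [hunion, Set.ncard_union_eq _ (hSfin.image _) (hSfin.image _),
        Set.ncard_image_of_injective _ hi1, Set.ncard_image_of_injective _ hi2]
      rw [Set.disjoint_left]
      rintro _ ⟨t, ht, rfl⟩ ⟨t', ht', h⟩
      have h := congrArg Complex.im h
      simp at h
      linarith [ht.1, ht'.1]
    omega
  have hcard' : hSfin.toFinset.card = m := by rw [← Set.ncard_eq_toFinset_card S hSfin, hcard]
  have hrange : Set.range (hSfin.toFinset.orderEmbOfFin hcard') = S := by
    rw [Finset.range_orderEmbOfFin]; simp
  have hmem : ∀ μ, hSfin.toFinset.orderEmbOfFin hcard' μ ∈ S := fun μ =>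
    hrange.subset ⟨μ, rfl⟩
  refine ⟨hSfin.toFinset.orderEmbOfFin hcard', fun μ => (hmem μ).1,
    (hSfin.toFinset.orderEmbOfFin hcard').strictMono, fun z => ?_⟩
  change z ∈ L ↔ _
  rw [hunion]
  constructor
  · rintro (⟨t, ht, rfl⟩ | ⟨t, ht, rfl⟩) <;> rw [← hrange] at ht <;> obtain ⟨μ, rfl⟩ := ht
    · exact ⟨μ, true, by simp [eigVal]⟩
    · exact ⟨μ, false, by simp [eigVal]⟩
  · rintro ⟨μ, s, rfl⟩
    cases s
    · right; exact ⟨_, hmem μ, by simp [eigVal]⟩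
    · left; exact ⟨_, hmem μ, by simp [eigVal]⟩

end Pairs

/-! ### Bases of eigenvectors of the complexification. -/

section Eigenbasis

variable {V : Type*} [AddCommGroup V] [Module ℝ V] {m : ℕ}

/-- `b` is a basis of eigenvectors of the complexification of `A`, with eigenvalues `± i a μ`. -/
def IsEigenbasis (A : V →ₗ[ℝ] V) (a : Fin m → ℝ) (b : Basis (Fin m × Bool) ℂ (ℂ ⊗[ℝ] V)) : Prop :=
  ∀ k, A.baseChange ℂ (b k) = eigVal (a k.1) k.2 • b k

lemma exists_isEigenbasis [FiniteDimensional ℝ V] (hdim : finrank ℝ V = 2 * m) {A : V →ₗ[ℝ] V}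
    {a : Fin m → ℝ} (ha : ∀ μ, 0 < a μ) (hinj : Function.Injective a)
    (h : ∀ μ s, Module.End.HasEigenvalue (A.baseChange ℂ) (eigVal (a μ) s)) :
    ∃ b, IsEigenbasis A a b := by
  choose v hv using fun k : Fin m × Bool => (h k.1 k.2).exists_hasEigenvector
  have hli : LinearIndependent ℂ v :=
    Module.End.eigenvectors_linearIndependent' _ _ (eigVal_inj ha hinj) v hv
  refine ⟨Basis.mk hli ?_, fun k => ?_⟩
  · refine (hli.span_eq_top_of_card_eq_finrank' ?_).ge
    rw [Module.finrank_baseChange, hdim]; simp [mul_comm]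
  · rw [Basis.mk_apply]; exact (hv k).apply_eq_smul

namespace IsEigenbasis

variable {A : V →ₗ[ℝ] V} {a : Fin m → ℝ} {b : Basis (Fin m × Bool) ℂ (ℂ ⊗[ℝ] V)}

lemma aeval_apply (hb : IsEigenbasis A a b) (q : Polynomial ℝ) (k : Fin m × Bool) :
    (Polynomial.aeval A q : Module.End ℝ V).baseChange ℂ (b k) =
      (q.map (algebraMap ℝ ℂ)).eval (eigVal (a k.1) k.2) • b k :=
  aeval_baseChange_apply (hb k) q

/-- Both sides are diagonal in the eigenbasis, and a real endomorphism is determined by its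
complexification. This reduces the algebra of polynomials in `A` to evaluation on the spectrum. -/
lemma aeval_eq (hb : IsEigenbasis A a b) {p q : Polynomial ℝ}
    (h : ∀ μ s, (p.map (algebraMap ℝ ℂ)).eval (eigVal (a μ) s) =
      (q.map (algebraMap ℝ ℂ)).eval (eigVal (a μ) s)) :
    (Polynomial.aeval A p : Module.End ℝ V) = Polynomial.aeval A q := by
  apply LinearMap.baseChangeHom_injective (R := ℝ) (M := V) (S := ℂ) (N := V)
  refine b.ext fun k => ?_
  exact (hb.aeval_apply p k).trans ((h k.1 k.2 ▸ rfl : _ = _).trans (hb.aeval_apply q k).symm)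

lemma eigenspace_eq (hb : IsEigenbasis A a b) (ha : ∀ μ, 0 < a μ) (hinj : Function.Injective a)
    (k : Fin m × Bool) :
    Module.End.eigenspace (A.baseChange ℂ) (eigVal (a k.1) k.2) = Submodule.span ℂ {b k} := by
  apply le_antisymm
  · intro z hz
    rw [Module.End.mem_eigenspace_iff] at hz
    have h1 : A.baseChange ℂ z = ∑ j, (b.repr z j * eigVal (a j.1) j.2) • b j := by
      conv_lhs => rw [← b.sum_repr z]
      rw [map_sum]
      exact Finset.sum_congr rfl fun j _ => by rw [map_smul, hb j, smul_smul]
    have h2 : ∀ j, b.repr z j * eigVal (a j.1) j.2 = eigVal (a k.1) k.2 * b.repr z j := by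
      intro j
      have := congrArg (fun y => b.repr y j) (h1.symm.trans hz)
      simpa [Finsupp.single_apply] using this
    have h3 : ∀ j, j ≠ k → b.repr z j = 0 := by
      intro j hj
      by_contra hne
      have := h2 j
      rw [mul_comm] at this
      exact hj (eigVal_inj ha hinj (mul_right_cancel₀ hne this))
    rw [Submodule.mem_span_singleton]
    refine ⟨b.repr z k, ?_⟩
    conv_rhs => rw [← b.sum_repr z]
    rw [Finset.sum_eq_single k (fun j _ hj => by rw [h3 j hj, zero_smul]) (by simp)]
  · rw [Submodule.span_singleton_le_iff_mem, Module.End.mem_eigenspace_iff]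
    exact hb k

/-- The values of the characteristic polynomial on the imaginary axis. -/
lemma eval_charpoly [FiniteDimensional ℝ V] (hb : IsEigenbasis A a b) (τ : ℝ) :
    (A.charpoly.map (algebraMap ℝ ℂ)).eval ((τ : ℂ) * Complex.I) =
      ((∏ μ, (a μ ^ 2 - τ ^ 2) : ℝ) : ℂ) := by
  classical
  have hdiag : LinearMap.toMatrix b b (A.baseChange ℂ) =
      Matrix.diagonal fun k => eigVal (a k.1) k.2 := by
    ext i j
    rw [LinearMap.toMatrix_apply, hb j, Matrix.diagonal_apply]
    by_cases hij : i = j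
    · simp [hij]
    · simp [hij]
  rw [← LinearMap.charpoly_baseChange, ← LinearMap.charpoly_toMatrix _ b, hdiag,
    Matrix.charpoly_diagonal, Polynomial.eval_prod, Fintype.prod_prod_type, Complex.ofReal_prod]
  refine Finset.prod_congr rfl fun μ _ => ?_
  simp only [Fintype.prod_bool, eigVal, Polynomial.eval_sub, Polynomial.eval_X,
    Polynomial.eval_C, if_true]
  simp only [Bool.false_eq_true, if_false]
  push_cast
  linear_combination ((τ:ℂ)^2 - (a μ:ℂ)^2) * Complex.I_sq

end IsEigenbasis

end Eigenbasis

/-! ### Interpolation polynomials on the spectrum. -/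

section Polynomials

open Polynomial

variable {m : ℕ}

/-- The polynomial taking the value `1` at `± i a μ` and `0` at `± i a ν` for `ν ≠ μ`. -/
noncomputable def projPoly (a : Fin m → ℝ) (μ : Fin m) : ℝ[X] :=
  ∏ ν ∈ Finset.univ.erase μ, C ((a ν ^ 2 - a μ ^ 2)⁻¹) * (X ^ 2 + C (a ν ^ 2))

/-- The polynomial taking the value `i` at the eigenvalues selected by `s`, and `-i` at their
negatives. -/
noncomputable def structPoly (a : Fin m → ℝ) (s : Fin m → Bool) : ℝ[X] :=
  ∑ μ, C (if s μ then (a μ)⁻¹ else -(a μ)⁻¹) * (X * projPoly a μ)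

variable {a : Fin m → ℝ}

lemma sq_sub_sq_ne_zero (ha : ∀ μ, 0 < a μ) (hinj : Function.Injective a) {μ ν : Fin m}
    (h : ν ≠ μ) : a ν ^ 2 - a μ ^ 2 ≠ 0 := by
  rw [sub_ne_zero]
  intro h'
  exact h (hinj ((pow_left_inj₀ (ha ν).le (ha μ).le two_ne_zero).1 h'))

lemma eval_projPoly (ha : ∀ μ, 0 < a μ) (hinj : Function.Injective a) (μ κ : Fin m) (t : Bool) :
    ((projPoly a μ).map (algebraMap ℝ ℂ)).eval (eigVal (a κ) t) = if μ = κ then 1 else 0 := by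
  rw [projPoly, Polynomial.map_prod, Polynomial.eval_prod]
  have hterm : ∀ ν, ((C ((a ν ^ 2 - a μ ^ 2)⁻¹) * (X ^ 2 + C (a ν ^ 2))).map
      (algebraMap ℝ ℂ)).eval (eigVal (a κ) t) =
      (((a ν ^ 2 - a μ ^ 2)⁻¹ * (a ν ^ 2 - a κ ^ 2) : ℝ) : ℂ) := fun ν => by
    simp only [Polynomial.map_mul, Polynomial.map_add, Polynomial.map_pow, map_X, map_C, eval_mul,
      eval_add, eval_pow, eval_X, eval_C, eigVal_sq, Complex.coe_algebraMap]
    push_cast; ring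
  rw [Finset.prod_congr rfl fun ν _ => hterm ν]
  split_ifs with h
  · subst h
    refine Finset.prod_eq_one fun ν hν => ?_
    rw [inv_mul_cancel₀ (sq_sub_sq_ne_zero ha hinj (Finset.ne_of_mem_erase hν))]
    simp
  · exact Finset.prod_eq_zero (Finset.mem_erase.2 ⟨Ne.symm h, Finset.mem_univ κ⟩) (by simp)

lemma eval_structPoly (ha : ∀ μ, 0 < a μ) (hinj : Function.Injective a) (s : Fin m → Bool)
    (κ : Fin m) (t : Bool) :
    ((structPoly a s).map (algebraMap ℝ ℂ)).eval (eigVal (a κ) t) =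
      if s κ = t then Complex.I else -Complex.I := by
  rw [structPoly, Polynomial.map_sum, Polynomial.eval_finsetSum, Finset.sum_eq_single κ]
  · simp only [Polynomial.map_mul, map_X, map_C, eval_mul, eval_X, eval_C,
      eval_projPoly ha hinj, if_true, mul_one]
    have h : ((a κ : ℝ) : ℂ) ≠ 0 := by exact_mod_cast (ha κ).ne'
    cases hs : s κ <;> cases t <;> simp [eigVal, h]
  · intro μ _ hμ
    simp [eval_projPoly ha hinj, hμ]
  · simp

lemma eigVal_neg (t : ℝ) (s : Bool) : -eigVal t s = eigVal t (!s) := by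
  cases s <;> simp [eigVal]

end Polynomials

/-! ### Projections and almost complex structures as polynomials in `A`. -/

section Algebra

open Polynomial

variable {V : Type*} [AddCommGroup V] [Module ℝ V] {m : ℕ} {A : Module.End ℝ V}
  {a : Fin m → ℝ} {b : Basis (Fin m × Bool) ℂ (ℂ ⊗[ℝ] V)}

lemma IsEigenbasis.structPoly_sq (hb : IsEigenbasis A a b) (ha : ∀ μ, 0 < a μ)
    (hinj : Function.Injective a) (s : Fin m → Bool) (v : V) :
    aeval A (structPoly a s) (aeval A (structPoly a s) v) = -v := by
  have h : (aeval A (structPoly a s * structPoly a s) : Module.End ℝ V) =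
      aeval A (C (-1 : ℝ)) := by
    refine hb.aeval_eq fun μ t => ?_
    rw [Polynomial.map_mul, eval_mul, eval_structPoly ha hinj]
    split_ifs <;> simp
  have h := LinearMap.congr_fun h v
  rw [map_mul, aeval_C] at h
  simpa using h

/-- The polynomial projects onto the real plane belonging to the pair `± i a μ`, and there `A² = -a
μ²`. -/
lemma IsEigenbasis.sq_projPoly (hb : IsEigenbasis A a b) (ha : ∀ μ, 0 < a μ)
    (hinj : Function.Injective a) (μ : Fin m) (v : V) :
    A (A (aeval A (projPoly a μ) v)) = -(a μ ^ 2) • aeval A (projPoly a μ) v := by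
  have h : (aeval A (X * (X * projPoly a μ)) : Module.End ℝ V) =
      aeval A (C (-(a μ ^ 2)) * projPoly a μ) := by
    refine hb.aeval_eq fun κ t => ?_
    simp only [Polynomial.map_mul, map_X, map_C, eval_mul, eval_X, eval_C,
      eval_projPoly ha hinj, Complex.coe_algebraMap]
    split_ifs with h
    · subst h
      rw [← eigVal_sq _ t]; ring
    · simp
  have h := LinearMap.congr_fun h v
  simpa only [map_mul, aeval_X, aeval_C, Module.End.mul_apply,
    Module.algebraMap_end_apply] using h

lemma IsEigenbasis.exists_projPoly_ne_zero (hb : IsEigenbasis A a b) (ha : ∀ μ, 0 < a μ)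
    (hinj : Function.Injective a) (μ : Fin m) : ∃ v, aeval A (projPoly a μ) v ≠ 0 := by
  by_contra! h
  have h0 : (aeval A (projPoly a μ) : Module.End ℝ V) = 0 := LinearMap.ext h
  have h1 := hb.aeval_apply (projPoly a μ) (μ, true)
  rw [h0, eval_projPoly ha hinj, if_pos rfl, one_smul] at h1
  apply b.ne_zero (μ, true)
  rw [← h1]; simp

/-- A vector in the image of the `μ`-th projection gives rise to an eigenvector. -/
lemma IsEigenbasis.mem_eigenspace_of_projPoly (hb : IsEigenbasis A a b) (ha : ∀ μ, 0 < a μ)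
    (hinj : Function.Injective a) (μ : Fin m) (s : Bool) (v : V) :
    (1 : ℂ) ⊗ₜ[ℝ] aeval A (projPoly a μ) v +
      Complex.I ⊗ₜ[ℝ] ((if s then -(a μ)⁻¹ else (a μ)⁻¹) • A (aeval A (projPoly a μ) v)) ∈
      Module.End.eigenspace (A.baseChange ℂ) (eigVal (a μ) s) := by
  rw [Module.End.mem_eigenspace_iff, baseChange_apply_eq_smul_iff]
  have h := (ha μ).ne'
  rw [map_smul, hb.sq_projPoly ha hinj, smul_smul, smul_smul]
  cases s <;> simp [eigVal, h] <;> congr 1 <;> field_simp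

/-- On the eigenbasis the structure acts by `i` or `-i` according to whether the vector is selected.
In the expansion of a vector of its `i`-eigenspace, a coefficient `c` at an unselected vector
satisfies `2 i c = 0`. -/
lemma IsEigenbasis.eigenspace_structPoly (hb : IsEigenbasis A a b) (ha : ∀ μ, 0 < a μ)
    (hinj : Function.Injective a) (s : Fin m → Bool) :
    Module.End.eigenspace ((aeval A (structPoly a s) : Module.End ℝ V).baseChange ℂ) Complex.I =
      ⨆ μ, Module.End.eigenspace (A.baseChange ℂ) (eigVal (a μ) (s μ)) := by
  apply le_antisymm
  · intro z hz
    rw [Module.End.mem_eigenspace_iff] at hz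
    have h1 : (aeval A (structPoly a s) : Module.End ℝ V).baseChange ℂ z =
        ∑ j, (b.repr z j * if s j.1 = j.2 then Complex.I else -Complex.I) • b j := by
      conv_lhs => rw [← b.sum_repr z]
      rw [map_sum]
      exact Finset.sum_congr rfl fun j _ => by
        rw [map_smul, hb.aeval_apply, eval_structPoly ha hinj, smul_smul]
    have h2 : ∀ j : Fin m × Bool, s j.1 ≠ j.2 → b.repr z j = 0 := by
      intro j hj
      have := congrArg (fun y => b.repr y j) (h1.symm.trans hz)
      simp only [map_sum, map_smul, b.repr_self, Finsupp.coe_finsetSum, Finset.sum_apply,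
        Finsupp.smul_apply, Finsupp.single_apply, smul_eq_mul, mul_ite, mul_one, mul_zero,
        Finset.sum_ite_eq', Finset.mem_univ, if_true, if_neg hj] at this
      have h3 : b.repr z j * (2 * Complex.I) = 0 := by linear_combination -this
      simpa using h3
    rw [← b.sum_repr z]
    refine Submodule.sum_mem _ fun j _ => ?_
    by_cases hj : s j.1 = j.2
    · refine Submodule.smul_mem _ _ (Submodule.mem_iSup_of_mem j.1 ?_)
      rw [Module.End.mem_eigenspace_iff, hj]
      exact hb j
    · rw [h2 j hj, zero_smul]; exact Submodule.zero_mem _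
  · refine iSup_le fun μ z hz => ?_
    rw [Module.End.mem_eigenspace_iff] at hz ⊢
    rw [aeval_baseChange_apply hz, eval_structPoly ha hinj, if_pos rfl]

/-- If `s` and `t` differ at `μ` but give the same space, then the structure of `t` acts on `b (μ, s
μ)` both by `i` and by `-i`. -/
lemma IsEigenbasis.iSup_eigenspace_injective (hb : IsEigenbasis A a b) (ha : ∀ μ, 0 < a μ)
    (hinj : Function.Injective a) :
    Function.Injective fun s : Fin m → Bool =>
      ⨆ μ, Module.End.eigenspace (A.baseChange ℂ) (eigVal (a μ) (s μ)) := by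
  intro s t h
  funext μ
  by_contra hne
  have hz : b (μ, s μ) ∈ ⨆ μ, Module.End.eigenspace (A.baseChange ℂ) (eigVal (a μ) (s μ)) :=
    Submodule.mem_iSup_of_mem μ (Module.End.mem_eigenspace_iff.2 (hb (μ, s μ)))
  rw [show (⨆ μ, Module.End.eigenspace (A.baseChange ℂ) (eigVal (a μ) (s μ))) =
    ⨆ μ, Module.End.eigenspace (A.baseChange ℂ) (eigVal (a μ) (t μ)) from h,
    ← hb.eigenspace_structPoly ha hinj, Module.End.mem_eigenspace_iff, hb.aeval_apply,
    eval_structPoly ha hinj, if_neg (Ne.symm hne)] at hz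
  have hz := smul_left_injective ℂ (b.ne_zero (μ, s μ)) hz
  have := congrArg Complex.im hz
  norm_num at this

/-- What commutes with `A` commutes with every polynomial in `A`. The integrability proof uses this
for `A` itself, for `J`, and for the tensor that measures the failure of integrability. -/
lemma apply_aeval_of_commute {S : Module.End ℝ V} (h : ∀ v, S (A v) = A (S v)) (q : ℝ[X]) (v : V) :
    S (aeval A q v) = aeval A q (S v) := by
  induction q using Polynomial.induction_on' generalizing v with
  | add p q hp hq => simp [hp, hq]
  | monomial n c =>
    rw [← C_mul_X_pow_eq_monomial]
    simp only [map_mul, aeval_C, map_pow, aeval_X, Module.End.mul_apply,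
      Module.algebraMap_end_apply, map_smul]
    congr 1
    induction n generalizing v with
    | zero => simp
    | succ n ih => rw [pow_succ]; simp [ih, h]

end Algebra

/-! ### Orthogonality and isotropy. -/

section Inner

open Polynomial

variable {V : Type*} [NormedAddCommGroup V] [InnerProductSpace ℝ V] {m : ℕ} {A : Module.End ℝ V}
  {a : Fin m → ℝ} {b : Basis (Fin m × Bool) ℂ (ℂ ⊗[ℝ] V)}

/-- The adjoint of `A` is `-A`, so the adjoint of `q(A)` is `q(-A)`. -/
lemma inner_aeval_left (hskew : ∀ v w, inner ℝ (A v) w = -(inner ℝ v (A w) : ℝ)) (q : ℝ[X])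
    (v w : V) : (inner ℝ (aeval A q v) w : ℝ) = inner ℝ v (aeval A (q.comp (-X)) w) := by
  induction q using Polynomial.induction_on' generalizing v with
  | add p q hp hq => simp [inner_add_left, inner_add_right, hp, hq]
  | monomial n c =>
    rw [← C_mul_X_pow_eq_monomial]
    simp only [mul_comp, C_comp, X_pow_comp, map_mul, aeval_C, map_pow, aeval_X, map_neg,
      Module.End.mul_apply, Module.algebraMap_end_apply, real_inner_smul_left,
      real_inner_smul_right]
    congr 1
    induction n generalizing v w with
    | zero => simp
    | succ n ih =>
      rw [pow_succ, Module.End.mul_apply, ih, hskew, pow_succ', Module.End.mul_apply]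
      simp

/-- Negating an eigenvalue negates the value of the polynomial, so the adjoint of the structure `S`
is `-S`, which is `S⁻¹`. -/
lemma IsEigenbasis.inner_structPoly (hb : IsEigenbasis A a b) (ha : ∀ μ, 0 < a μ)
    (hinj : Function.Injective a) (hskew : ∀ v w, inner ℝ (A v) w = -(inner ℝ v (A w) : ℝ))
    (s : Fin m → Bool) (v w : V) :
    (inner ℝ (aeval A (structPoly a s) v) (aeval A (structPoly a s) w) : ℝ) = inner ℝ v w := by
  have h : (aeval A ((structPoly a s).comp (-X)) : Module.End ℝ V) =
      aeval A (C (-1) * structPoly a s) := by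
    refine hb.aeval_eq fun μ t => ?_
    rw [Polynomial.map_comp, eval_comp]
    simp only [Polynomial.map_neg, map_X, eval_neg, eval_X, Polynomial.map_mul, map_C, eval_mul,
      eval_C, eigVal_neg, eval_structPoly ha hinj]
    cases s μ <;> cases t <;> simp
  rw [inner_aeval_left hskew, h, map_mul, Module.End.mul_apply, hb.structPoly_sq ha hinj, aeval_C]
  simp

lemma baseChange_inner_apply_baseChange {S : V →ₗ[ℝ] V}
    (hS : ∀ v w, inner ℝ (S v) (S w) = (inner ℝ v w : ℝ)) (y z : ℂ ⊗[ℝ] V) :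
    LinearMap.BilinForm.baseChange ℂ (innerₗ V) (S.baseChange ℂ y) (S.baseChange ℂ z) =
      LinearMap.BilinForm.baseChange ℂ (innerₗ V) y z := by
  induction y using TensorProduct.induction_on with
  | zero => simp
  | add x y hx hy => simp only [map_add, LinearMap.add_apply, hx, hy]
  | tmul c v =>
    induction z using TensorProduct.induction_on with
    | zero => simp
    | add x y hx hy => simp only [map_add, hx, hy]
    | tmul d w =>
      simp only [LinearMap.baseChange_tmul, LinearMap.BilinForm.baseChange_tmul,
        innerₗ_apply_apply, hS]

/-- The `i`-eigenspace of an orthogonal endomorphism is isotropic. -/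
lemma baseChange_inner_eq_zero {S : V →ₗ[ℝ] V}
    (hS : ∀ v w, inner ℝ (S v) (S w) = (inner ℝ v w : ℝ)) {y z : ℂ ⊗[ℝ] V}
    (hy : y ∈ Module.End.eigenspace (S.baseChange ℂ) Complex.I)
    (hz : z ∈ Module.End.eigenspace (S.baseChange ℂ) Complex.I) :
    LinearMap.BilinForm.baseChange ℂ (innerₗ V) y z = 0 := by
  rw [Module.End.mem_eigenspace_iff] at hy hz
  have h := baseChange_inner_apply_baseChange hS y z
  rw [hy, hz, map_smul, map_smul, LinearMap.smul_apply, smul_smul, Complex.I_mul_I, neg_one_smul]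
    at h
  exact self_eq_neg.1 h.symm

end Inner

/-! ### Smooth tensor fields in local coordinates. -/

section Smooth

variable {E : Type*} [NormedAddCommGroup E] [NormedSpace ℝ E]
  {M : Type*} [TopologicalSpace M] [ChartedSpace E M] [IsManifold 𝓘(ℝ, E) ∞ M]

/-- The coordinate expression of an endomorphism of a tangent space. -/
noncomputable def endCoord (x₀ x : M)
    (B : TangentSpace 𝓘(ℝ, E) x →L[ℝ] TangentSpace 𝓘(ℝ, E) x) : E →L[ℝ] E :=
  ContinuousLinearMap.inCoordinates E (TangentSpace 𝓘(ℝ, E) : M → Type _)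
    E (TangentSpace 𝓘(ℝ, E) : M → Type _) x₀ x x₀ x B

/-- The coordinate expression of a bilinear form on a tangent space. -/
noncomputable def bilinCoord (x₀ x : M)
    (β : TangentSpace 𝓘(ℝ, E) x →L[ℝ] TangentSpace 𝓘(ℝ, E) x →L[ℝ] ℝ) : E →L[ℝ] E →L[ℝ] ℝ :=
  ContinuousLinearMap.inCoordinates E (TangentSpace 𝓘(ℝ, E) : M → Type _)
    (E →L[ℝ] ℝ) (fun x : M => TangentSpace 𝓘(ℝ, E) x →L[ℝ] Bundle.Trivial M ℝ x) x₀ x x₀ x β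

lemma contMDiffAt_end_iff {J : EndField E M} {x₀ : M} :
    ContMDiffAt 𝓘(ℝ, E) (𝓘(ℝ, E).prod 𝓘(ℝ, E →L[ℝ] E)) ∞
      (fun x => TotalSpace.mk' (E →L[ℝ] E)
        (E := fun x : M => TangentSpace 𝓘(ℝ, E) x →L[ℝ] TangentSpace 𝓘(ℝ, E) x) x (J x)) x₀ ↔
    ContMDiffAt 𝓘(ℝ, E) 𝓘(ℝ, E →L[ℝ] E) ∞ (fun x => endCoord x₀ x (J x)) x₀ := by
  rw [contMDiffAt_hom_bundle]
  exact and_iff_right contMDiffAt_id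

lemma contMDiffAt_bilin_iff {β : BilinField E M} {x₀ : M} :
    ContMDiffAt 𝓘(ℝ, E) (𝓘(ℝ, E).prod 𝓘(ℝ, E →L[ℝ] E →L[ℝ] ℝ)) ∞
      (fun x => TotalSpace.mk' (E →L[ℝ] E →L[ℝ] ℝ)
        (E := fun x : M => TangentSpace 𝓘(ℝ, E) x →L[ℝ] TangentSpace 𝓘(ℝ, E) x →L[ℝ] ℝ) x (β x))
        x₀ ↔
    ContMDiffAt 𝓘(ℝ, E) 𝓘(ℝ, E →L[ℝ] E →L[ℝ] ℝ) ∞ (fun x => bilinCoord x₀ x (β x)) x₀ := by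
  rw [contMDiffAt_hom_bundle]
  exact and_iff_right contMDiffAt_id

/-- The set on which the coordinates centered at `x₀` are defined. -/
def coordSet (E : Type*) [NormedAddCommGroup E] [NormedSpace ℝ E]
  {M : Type*} [TopologicalSpace M] [ChartedSpace E M] [IsManifold 𝓘(ℝ, E) ∞ M] (x₀ : M) : Set M :=
  (trivializationAt E (TangentSpace 𝓘(ℝ, E) : M → Type _) x₀).baseSet

variable (E) in
lemma coordSet_mem_nhds (x₀ : M) : coordSet E x₀ ∈ nhds x₀ :=
  (trivializationAt E (TangentSpace 𝓘(ℝ, E) : M → Type _) x₀).open_baseSet.mem_nhds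
    (FiberBundle.mem_baseSet_trivializationAt' x₀)

/-- The coordinates on the tangent space at `x` centered at `x₀`. -/
noncomputable def coordEquiv {x₀ x : M} (hx : x ∈ coordSet E x₀) : TangentSpace 𝓘(ℝ, E) x ≃L[ℝ] E :=
  (trivializationAt E (TangentSpace 𝓘(ℝ, E) : M → Type _) x₀).continuousLinearEquivAt ℝ x hx

lemma endCoord_apply {x₀ x : M} (hx : x ∈ coordSet E x₀)
    (B : TangentSpace 𝓘(ℝ, E) x →L[ℝ] TangentSpace 𝓘(ℝ, E) x) (v : E) :
    endCoord x₀ x B v = coordEquiv hx (B ((coordEquiv hx).symm v)) := by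
  rw [endCoord, ContinuousLinearMap.inCoordinates_eq hx hx]
  rfl

lemma bilinCoord_apply {x₀ x : M} (hx : x ∈ coordSet E x₀)
    (β : TangentSpace 𝓘(ℝ, E) x →L[ℝ] TangentSpace 𝓘(ℝ, E) x →L[ℝ] ℝ) (v w : E) :
    bilinCoord x₀ x β v w = β ((coordEquiv hx).symm v) ((coordEquiv hx).symm w) := by
  rw [bilinCoord, inCoordinates_apply_eq₂ hx hx (Set.mem_univ _)]
  simp [coordEquiv]
  rfl

lemma isSmoothEnd_of_coord {J : EndField E M}
    (h : ∀ x₀, ∃ f : M → E →L[ℝ] E, ContMDiffAt 𝓘(ℝ, E) 𝓘(ℝ, E →L[ℝ] E) ∞ f x₀ ∧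
      ∀ᶠ x in nhds x₀, ∀ hx : x ∈ coordSet E x₀, ∀ v,
        f x v = coordEquiv hx (J x ((coordEquiv hx).symm v))) : IsSmoothEnd J := by
  intro x₀
  obtain ⟨f, hf, hfJ⟩ := h x₀
  rw [contMDiffAt_end_iff]
  refine hf.congr_of_eventuallyEq ?_
  filter_upwards [hfJ, coordSet_mem_nhds E x₀] with x hx hx'
  ext v
  rw [endCoord_apply hx', hx hx']

lemma IsSmoothEnd.coord {J : EndField E M} (h : IsSmoothEnd J) (x₀ : M) :
    ContMDiffAt 𝓘(ℝ, E) 𝓘(ℝ, E →L[ℝ] E) ∞ (fun x => endCoord x₀ x (J x)) x₀ :=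
  contMDiffAt_end_iff.1 (h x₀)

lemma IsSmoothEnd.comp {J K : EndField E M} (hJ : IsSmoothEnd J) (hK : IsSmoothEnd K) :
    IsSmoothEnd fun x => (J x).comp (K x) :=
  isSmoothEnd_of_coord fun x₀ => ⟨_, (hJ.coord x₀).clm_comp (hK.coord x₀),
    Filter.Eventually.of_forall fun x hx v => by simp [endCoord_apply hx]⟩

lemma IsSmoothEnd.add {J K : EndField E M} (hJ : IsSmoothEnd J) (hK : IsSmoothEnd K) :
    IsSmoothEnd fun x => J x + K x :=
  isSmoothEnd_of_coord fun x₀ => ⟨_, (hJ.coord x₀).add (hK.coord x₀),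
    Filter.Eventually.of_forall fun x hx v => by simp [endCoord_apply hx]⟩

lemma IsSmoothEnd.smul {f : M → ℝ} {J : EndField E M} (hf : ContMDiff 𝓘(ℝ, E) 𝓘(ℝ, ℝ) ∞ f)
    (hJ : IsSmoothEnd J) : IsSmoothEnd fun x => f x • J x :=
  isSmoothEnd_of_coord fun x₀ => ⟨_, (hf x₀).smul (hJ.coord x₀),
    Filter.Eventually.of_forall fun x hx v => by simp [endCoord_apply hx]⟩

lemma isSmoothEnd_id : IsSmoothEnd fun x : M => ContinuousLinearMap.id ℝ (TangentSpace 𝓘(ℝ, E) x) :=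
  isSmoothEnd_of_coord fun x₀ => ⟨fun _ => ContinuousLinearMap.id ℝ E, contMDiffAt_const,
    Filter.Eventually.of_forall fun x hx v => by simp⟩

lemma IsSmoothEnd.contMDiffAt_app {J : EndField E M} (hJ : IsSmoothEnd J) {X : VField E M} {x : M}
    (hX : CMDiffAt ∞ (T% X) x) : CMDiffAt ∞ (T% (J.app X)) x :=
  ContMDiffAt.clm_bundle_apply (hJ x) hX

lemma IsSmoothEnd.mdifferentiableAt_app {J : EndField E M} (hJ : IsSmoothEnd J) {X : VField E M}
    {x : M} (hX : MDiffAt (T% X) x) : MDiffAt (T% (J.app X)) x :=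
  MDifferentiableAt.clm_bundle_apply ((hJ x).mdifferentiableAt (by simp)) hX

lemma IsTwoForm.swap {β : BilinField E M} (hβ : IsTwoForm β) {x : M}
    (v w : TangentSpace 𝓘(ℝ, E) x) : -β x v w = β x w v := by
  have h := hβ.alt x (v + w)
  simp only [map_add, _root_.add_apply, hβ.alt] at h
  linarith

end Smooth

/-! ### Smoothness of raising an index and of the fundamental form. -/

section SmoothRiemannian

variable {E : Type*} [NormedAddCommGroup E] [NormedSpace ℝ E] [FiniteDimensional ℝ E]
  {M : Type*} [TopologicalSpace M] [ChartedSpace E M] [IsManifold 𝓘(ℝ, E) ∞ M]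
  [RiemannianBundle (fun x : M => TangentSpace 𝓘(ℝ, E) x)]
  [IsContMDiffRiemannianBundle 𝓘(ℝ, E) ∞ E (fun x : M => TangentSpace 𝓘(ℝ, E) x)]

variable (E) in
lemma exists_coord_inner (x₀ : M) : ∃ G : M → E →L[ℝ] E →L[ℝ] ℝ,
    ContMDiffAt 𝓘(ℝ, E) 𝓘(ℝ, E →L[ℝ] E →L[ℝ] ℝ) ∞ G x₀ ∧
    ∀ x (hx : x ∈ coordSet E x₀) v w,
      G x v w = inner ℝ ((coordEquiv hx).symm v) ((coordEquiv hx).symm w) := by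
  obtain ⟨g, hg, hgi⟩ := IsContMDiffRiemannianBundle.exists_contMDiff (IB := 𝓘(ℝ, E)) (n := ∞)
    (F := E) (E := fun x : M => TangentSpace 𝓘(ℝ, E) x)
  refine ⟨fun x => bilinCoord x₀ x (g x), contMDiffAt_bilin_iff.1 (hg x₀), fun x hx v w => ?_⟩
  rw [bilinCoord_apply hx, hgi]

lemma IsTwoForm.isSmoothEnd_sharp {β : BilinField E M} (hβ : IsTwoForm β) :
    IsSmoothEnd (sharp β) := by
  refine isSmoothEnd_of_coord fun x₀ => ?_
  obtain ⟨G, hG, hGi⟩ := exists_coord_inner E x₀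
  have hx₀ : x₀ ∈ coordSet E x₀ := mem_of_mem_nhds (coordSet_mem_nhds E x₀)
  have hinj : ∀ x ∈ coordSet E x₀, Function.Injective (G x) := by
    intro x hx
    rw [injective_iff_map_eq_zero]
    intro v hv
    have h := hGi x hx v v
    rw [hv] at h
    simpa using h.symm
  have hfr : finrank ℝ E = finrank ℝ (E →L[ℝ] ℝ) := by
    rw [← LinearMap.toContinuousLinearMap.finrank_eq (R := ℝ) (M := E →ₗ[ℝ] ℝ)]
    exact (Subspace.dual_finrank_eq (K := ℝ) (V := E)).symm
  have heq : ∀ x ∈ coordSet E x₀, ∃ e : E ≃L[ℝ] (E →L[ℝ] ℝ), (e : E →L[ℝ] (E →L[ℝ] ℝ)) = G x := by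
    intro x hx
    refine ⟨(LinearEquiv.ofInjectiveOfFinrankEq (G x : E →ₗ[ℝ] (E →L[ℝ] ℝ))
      (hinj x hx) hfr).toContinuousLinearEquiv, ?_⟩
    ext v w; rfl
  have hβc := contMDiffAt_bilin_iff.1 (hβ.smooth x₀)
  -- In coordinates, raising an index is composition with the inverse Gram operator. The sign
  -- appears because `g(v, Aw) = β(v, w)` puts the argument of `A` in the second slot of `β`.
  refine ⟨fun x => (G x).inverse.comp (-bilinCoord x₀ x (β x)), ?_, ?_⟩
  · refine ContMDiffAt.clm_comp ?_ ?_
    · obtain ⟨e, he⟩ := heq x₀ hx₀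
      have h := contDiffAt_map_inverse (𝕜 := ℝ) (n := ∞) e
      rw [he] at h
      exact h.contMDiffAt.comp x₀ hG
    · exact hβc.neg
  · refine Filter.Eventually.of_forall fun x hx v => hinj x hx ?_
    obtain ⟨e, he⟩ := heq x hx
    rw [ContinuousLinearMap.comp_apply, ← he, ContinuousLinearMap.inverse_equiv]
    simp only [ContinuousLinearEquiv.coe_coe, ContinuousLinearEquiv.apply_symm_apply]
    rw [← ContinuousLinearEquiv.coe_coe, he]
    ext w
    rw [hGi x hx, _root_.neg_apply, _root_.neg_apply,
      bilinCoord_apply hx, real_inner_comm, ContinuousLinearEquiv.symm_apply_apply, inner_sharp,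
      hβ.swap]

lemma IsSmoothEnd.contMDiff_fundForm {J : EndField E M} (hJ : IsSmoothEnd J) :
    ContMDiff 𝓘(ℝ, E) (𝓘(ℝ, E).prod 𝓘(ℝ, E →L[ℝ] E →L[ℝ] ℝ)) ∞
      (fun x => TotalSpace.mk' (E →L[ℝ] E →L[ℝ] ℝ)
        (E := fun x : M => TangentSpace 𝓘(ℝ, E) x →L[ℝ] TangentSpace 𝓘(ℝ, E) x →L[ℝ] ℝ) x
        (fundForm J x)) := by
  intro x₀
  obtain ⟨G, hG, hGi⟩ := exists_coord_inner E x₀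
  rw [contMDiffAt_bilin_iff]
  refine (hG.clm_comp (hJ.coord x₀)).congr_of_eventuallyEq ?_
  filter_upwards [coordSet_mem_nhds E x₀] with x hx
  ext v w
  simp only [bilinCoord_apply hx, ContinuousLinearMap.comp_apply, endCoord_apply hx, hGi x hx,
    ContinuousLinearEquiv.symm_apply_apply, fundForm_apply]

lemma IsTwoForm.shiftedForm {J : EndField E M} {ψ : BilinField E M} {σ : M → ℝ}
    (hJ : IsSmoothEnd J) (hJs : ∀ x v, inner ℝ (J x v) v = (0 : ℝ)) (hψ : IsTwoForm ψ)
    (hσ : ContMDiff 𝓘(ℝ, E) 𝓘(ℝ, ℝ) ∞ σ) : IsTwoForm (shiftedForm J ψ σ) where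
  smooth := by
    intro x₀
    have h1 := contMDiffAt_bilin_iff.1 (hψ.smooth x₀)
    have h2 := contMDiffAt_bilin_iff.1 (hJ.contMDiff_fundForm x₀)
    rw [contMDiffAt_bilin_iff]
    have h3 : ContMDiffAt 𝓘(ℝ, E) 𝓘(ℝ, ℝ) ∞ (fun x => σ x / 2) x₀ :=
      (contDiff_id.div_const 2).contMDiff.contMDiffAt.comp x₀ (hσ x₀)
    have h4 : ContMDiffAt 𝓘(ℝ, E) 𝓘(ℝ, E →L[ℝ] E →L[ℝ] ℝ) ∞
        (fun x => (σ x / 2) • bilinCoord x₀ x (fundForm J x)) x₀ := h3.smul h2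
    refine (h1.sub h4).congr_of_eventuallyEq ?_
    filter_upwards [coordSet_mem_nhds E x₀] with x hx
    ext v w
    simp [bilinCoord_apply hx, HamiltonianForms.shiftedForm]
  alt x v := by simp [HamiltonianForms.shiftedForm, hψ.alt, fundForm_apply, hJs]

end SmoothRiemannian

/-! ### Smooth dependence of the eigenvalues on the point. -/

section EigenvalueSmooth

variable {E : Type*} [NormedAddCommGroup E] [NormedSpace ℝ E] [FiniteDimensional ℝ E]

/-- The real part of the characteristic polynomial on the imaginary axis. -/
noncomputable def imagCharpoly (p : (E →L[ℝ] E) × ℝ) : ℝ :=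
  (((p.1 : E →ₗ[ℝ] E).charpoly.map (algebraMap ℝ ℂ)).eval ((p.2 : ℂ) * Complex.I)).re

lemma contDiff_imagCharpoly : ContDiff ℝ ∞ (imagCharpoly (E := E)) := by
  classical
  let e := finBasis ℝ E
  -- The Leibniz expansion of the determinant shows that the function is polynomial in the matrix
  -- entries and `τ`.
  have h : imagCharpoly (E := E) = fun p =>
      (∑ g : Equiv.Perm (Fin (finrank ℝ E)), ((Equiv.Perm.sign g : ℤ) : ℂ) *
        ∏ i, ((if g i = i then (p.2 : ℂ) * Complex.I else 0) -
          ((e.repr (p.1 (e i)) (g i) : ℝ) : ℂ))).re := by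
    funext p
    rw [imagCharpoly, ← LinearMap.charpoly_toMatrix _ e, ← Matrix.charpoly_map,
      Matrix.eval_charpoly, Matrix.det_apply']
    congr 1
    refine Finset.sum_congr rfl fun g _ => ?_
    congr 1
    refine Finset.prod_congr rfl fun i _ => ?_
    simp [LinearMap.toMatrix_apply, Matrix.diagonal_apply]
  rw [h]
  refine Complex.reCLM.contDiff.comp (ContDiff.sum fun g _ => contDiff_const.mul ?_)
  refine contDiff_prod fun i _ => ContDiff.sub ?_ ?_
  · split_ifs
    · exact (Complex.ofRealCLM.contDiff.comp contDiff_snd).mul contDiff_const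
    · exact contDiff_const
  · refine Complex.ofRealCLM.contDiff.comp ?_
    have hc : ContDiff ℝ ∞ fun v : E => e.repr v (g i) :=
      (LinearMap.toContinuousLinearMap (e.coord (g i))).contDiff
    exact hc.comp (contDiff_fst.clm_apply contDiff_const)

lemma isInvertible_of_apply_one_ne_zero {f : ℝ →L[ℝ] ℝ} (h : f 1 ≠ 0) : f.IsInvertible := by
  refine ⟨ContinuousLinearEquiv.smulLeft (Units.mk0 _ h), ?_⟩
  ext
  simp

/-- Near an endomorphism whose characteristic polynomial on the imaginary axis has distinct
positive roots `c μ`, these roots extend to smooth functions. -/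
lemma exists_contDiffAt_root {m : ℕ} {B₀ : E →L[ℝ] E} {c : Fin m → ℝ} (hpos : ∀ μ, 0 < c μ)
    (hinj : Function.Injective c) (hB : ∀ τ, imagCharpoly (B₀, τ) = ∏ μ, (c μ ^ 2 - τ ^ 2))
    (μ : Fin m) :
    ∃ r : (E →L[ℝ] E) → ℝ, ContDiffAt ℝ ∞ r B₀ ∧ r B₀ = c μ ∧
      ∀ᶠ B in nhds B₀, imagCharpoly (B, r B) = 0 := by
  have hcd : ContDiffAt ℝ ∞ (imagCharpoly (E := E)) (B₀, c μ) := contDiff_imagCharpoly.contDiffAt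
  have hzero : imagCharpoly (B₀, c μ) = 0 := by
    rw [hB]; exact Finset.prod_eq_zero (Finset.mem_univ μ) (sub_self _)
  -- The root `c μ` is simple: the derivative in `τ` is a product of nonzero factors, as the
  -- implicit function theorem requires.
  have hder : HasDerivAt (fun τ => imagCharpoly (B₀, τ))
      (-(2 * c μ) * ∏ ν ∈ Finset.univ.erase μ, (c ν ^ 2 - c μ ^ 2)) (c μ) := by
    have h1 : (fun τ => imagCharpoly (B₀, τ)) = fun τ =>
        (c μ ^ 2 - τ ^ 2) * ∏ ν ∈ Finset.univ.erase μ, (c ν ^ 2 - τ ^ 2) := by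
      funext τ; rw [hB]
      exact (Finset.mul_prod_erase _ (fun ν => c ν ^ 2 - τ ^ 2) (Finset.mem_univ μ)).symm
    rw [h1]
    have h2 : HasDerivAt (fun τ : ℝ => c μ ^ 2 - τ ^ 2) (-(2 * c μ)) (c μ) := by
      simpa using (hasDerivAt_pow 2 (c μ)).const_sub (c μ ^ 2)
    have h3 : DifferentiableAt ℝ
        (fun τ : ℝ => ∏ ν ∈ Finset.univ.erase μ, (c ν ^ 2 - τ ^ 2)) (c μ) := by
      fun_prop
    have h4 := h2.mul h3.hasDerivAt
    rw [sub_self, zero_mul, add_zero] at h4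
    exact h4
  have hfd : HasFDerivAt (imagCharpoly (E := E)) (fderiv ℝ imagCharpoly (B₀, c μ)) (B₀, c μ) :=
    (hcd.differentiableAt (by simp)).hasFDerivAt
  have hval : (fderiv ℝ imagCharpoly (B₀, c μ) ∘L .inr ℝ (E →L[ℝ] E) ℝ) 1 =
      -(2 * c μ) * ∏ ν ∈ Finset.univ.erase μ, (c ν ^ 2 - c μ ^ 2) := by
    have h := hfd.comp_hasDerivAt (c μ) ((hasDerivAt_const (c μ) B₀).prodMk (hasDerivAt_id (c μ)))
    exact h.unique hder
  have hinv : (fderiv ℝ imagCharpoly (B₀, c μ) ∘L .inr ℝ (E →L[ℝ] E) ℝ).IsInvertible := by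
    refine isInvertible_of_apply_one_ne_zero ?_
    rw [hval]
    refine mul_ne_zero (by linarith [hpos μ]) (Finset.prod_ne_zero_iff.2 fun ν hν => ?_)
    exact sq_sub_sq_ne_zero hpos hinj (Finset.ne_of_mem_erase hν)
  refine ⟨hcd.implicitFunction (by simp) hinv, hcd.contDiffAt_implicitFunction (by simp) hinv,
    hcd.implicitFunction_apply_self (by simp) hinv, ?_⟩
  filter_upwards [hcd.eventually_apply_implicitFunction (by simp) hinv] with B h
  rw [h, hzero]

/-- The matching of indices is a strictly increasing self-map of `Fin m`, hence the identity. -/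
lemma eq_of_strictMono_of_forall_exists {m : ℕ} {c d : Fin m → ℝ} (hc : StrictMono c)
    (hd : StrictMono d) (h : ∀ μ, ∃ ν, d μ = c ν) : d = c := by
  choose f hf using h
  have hmono : StrictMono f := fun μ ν hμν => by
    have := hd hμν
    rw [hf, hf] at this
    exact hc.lt_iff_lt.1 this
  funext μ
  rw [hf, le_antisymm hmono.apply_le hmono.le_apply]

variable {M : Type*} [TopologicalSpace M] [ChartedSpace E M] [IsManifold 𝓘(ℝ, E) ∞ M]

lemma imagCharpoly_endCoord {x₀ x : M} (hx : x ∈ coordSet E x₀)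
    (B : TangentSpace 𝓘(ℝ, E) x →L[ℝ] TangentSpace 𝓘(ℝ, E) x) (τ : ℝ) :
    imagCharpoly (endCoord x₀ x B, τ) =
      (((LinearMap.charpoly (M := TangentSpace 𝓘(ℝ, E) x) B.toLinearMap).map
        (algebraMap ℝ ℂ)).eval ((τ : ℂ) * Complex.I)).re := by
  have h : (endCoord x₀ x B : E →ₗ[ℝ] E) =
      (coordEquiv hx).toLinearEquiv.conj B.toLinearMap := by
    ext v
    exact endCoord_apply hx B v
  rw [imagCharpoly, h, LinearEquiv.charpoly_conj]

lemma contMDiff_eigenvalue {m : ℕ} {B : EndField E M} (hB : IsSmoothEnd B) {a : Fin m → M → ℝ}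
    (hpos : ∀ x μ, 0 < a μ x) (hmono : ∀ x, StrictMono fun μ => a μ x)
    (hchar : ∀ x (τ : ℝ), ((LinearMap.charpoly (M := TangentSpace 𝓘(ℝ, E) x)
      (B x).toLinearMap).map (algebraMap ℝ ℂ)).eval ((τ : ℂ) * Complex.I) =
        ((∏ μ, (a μ x ^ 2 - τ ^ 2) : ℝ) : ℂ)) (μ : Fin m) :
    ContMDiff 𝓘(ℝ, E) 𝓘(ℝ, ℝ) ∞ (a μ) := by
  intro x₀
  have hx₀ : x₀ ∈ coordSet E x₀ := mem_of_mem_nhds (coordSet_mem_nhds E x₀)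
  have himag : ∀ x ∈ coordSet E x₀, ∀ τ : ℝ,
      imagCharpoly (endCoord x₀ x (B x), τ) = ∏ μ, (a μ x ^ 2 - τ ^ 2) := fun x hx τ => by
    rw [imagCharpoly_endCoord hx, hchar, Complex.ofReal_re]
  choose r hr hr0 hrz using exists_contDiffAt_root (hpos x₀) (hmono x₀).injective (himag x₀ hx₀)
  have hsm : ∀ ν, ContMDiffAt 𝓘(ℝ, E) 𝓘(ℝ, ℝ) ∞ (fun x => r ν (endCoord x₀ x (B x))) x₀ :=
    fun ν => (hr ν).contMDiffAt.comp x₀ (hB.coord x₀)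
  have hev1 : ∀ᶠ x in nhds x₀, ∀ ν, 0 < r ν (endCoord x₀ x (B x)) :=
    Filter.eventually_all.2 fun ν => (hsm ν).continuousAt.eventually
      (lt_mem_nhds ((hpos x₀ ν).trans_eq (hr0 ν).symm))
  have hev2 : ∀ᶠ x in nhds x₀, ∀ ν κ, ν < κ →
      r ν (endCoord x₀ x (B x)) < r κ (endCoord x₀ x (B x)) := by
    refine Filter.eventually_all.2 fun ν => Filter.eventually_all.2 fun κ => ?_
    by_cases h : ν < κ
    · have h0 : r ν (endCoord x₀ x₀ (B x₀)) < r κ (endCoord x₀ x₀ (B x₀)) := by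
        rw [hr0, hr0]; exact hmono x₀ h
      filter_upwards [(hsm ν).continuousAt.eventually_lt (hsm κ).continuousAt h0] with x hx _
      exact hx
    · exact Filter.Eventually.of_forall fun x h' => absurd h' h
  have hev3 : ∀ᶠ x in nhds x₀, ∀ ν, imagCharpoly (endCoord x₀ x (B x),
      r ν (endCoord x₀ x (B x))) = 0 :=
    Filter.eventually_all.2 fun ν => (hB.coord x₀).continuousAt.eventually (hrz ν)
  refine (hsm μ).congr_of_eventuallyEq ?_
  filter_upwards [hev1, hev2, hev3, coordSet_mem_nhds E x₀] with x h1 h2 h3 hx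
  -- Near `x₀` the implicit roots are still positive and increasing, and each is one of the `a κ x`;
  -- the ordering excludes any relabelling.
  refine (congrFun (eq_of_strictMono_of_forall_exists (hmono x) h2 fun ν => ?_) μ).symm
  have h := h3 ν
  rw [himag x hx, Finset.prod_eq_zero_iff] at h
  obtain ⟨κ, -, hκ⟩ := h
  exact ⟨κ, (pow_left_inj₀ (h1 ν).le (hpos x κ).le two_ne_zero).1 (sub_eq_zero.1 hκ).symm⟩

end EigenvalueSmooth

/-! ### Covariant derivatives of endomorphisms and the Nijenhuis tensor. -/

section Connection

variable {E : Type*} [NormedAddCommGroup E] [NormedSpace ℝ E] [FiniteDimensional ℝ E]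
  {M : Type*} [TopologicalSpace M] [ChartedSpace E M] [IsManifold 𝓘(ℝ, E) ∞ M]
  (cov : CovariantDerivative 𝓘(ℝ, E) E (fun x : M => TangentSpace 𝓘(ℝ, E) x))

/-- The two Leibniz terms containing the derivative of `f` cancel, since `B` is linear over
functions. -/
lemma tensorialAt_covEnd {B : EndField E M} (hB : IsSmoothEnd B) (x : M) :
    TensorialAt 𝓘(ℝ, E) E
      (fun X : VField E M => cov (B.app X) x - (B x).comp (cov X x)) x where
  smul {f X} hf hX := by
    have h : B.app (f • X) = f • B.app X := by
      funext y; simp [EndField.app]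
    have hBX := hB.mdifferentiableAt_app hX
    rw [h, cov.isCovariantDerivativeOnUniv.leibniz hX hf,
      cov.isCovariantDerivativeOnUniv.leibniz hBX hf]
    ext v
    simp [EndField.app, smul_sub]
  add {X Y} hX hY := by
    have h : B.app (X + Y) = B.app X + B.app Y := by
      funext y; simp [EndField.app]
    rw [h, cov.isCovariantDerivativeOnUniv.add hX hY, cov.isCovariantDerivativeOnUniv.add
      (hB.mdifferentiableAt_app hX) (hB.mdifferentiableAt_app hY)]
    ext v
    simp
    abel

/-- The covariant derivative `w ↦ v ↦ (∇_v B) w` of a field of endomorphisms. -/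
noncomputable def covEnd {B : EndField E M} (hB : IsSmoothEnd B) (x : M) :
    TangentSpace 𝓘(ℝ, E) x →L[ℝ] TangentSpace 𝓘(ℝ, E) x →L[ℝ] TangentSpace 𝓘(ℝ, E) x :=
  TensorialAt.mkHom _ x (tensorialAt_covEnd cov hB x)

variable {cov}

lemma covEnd_apply {B : EndField E M} (hB : IsSmoothEnd B) {x : M} {X : VField E M}
    (hX : MDiffAt (T% X) x) (v : TangentSpace 𝓘(ℝ, E) x) :
    covEnd cov hB x (X x) v = cov (B.app X) x v - B x (cov X x v) := by
  rw [covEnd, TensorialAt.mkHom_apply _ hX]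
  rfl

lemma exists_vField {x : M} (w : TangentSpace 𝓘(ℝ, E) x) :
    ∃ X : VField E M, MDiffAt (T% X) x ∧ X x = w :=
  ⟨FiberBundle.extend E w, FiberBundle.mdifferentiableAt_extend .., by simp⟩

/-- This is the derivative of `AB = BA`. -/
lemma covEnd_commute {A B : EndField E M} (hA : IsSmoothEnd A) (hB : IsSmoothEnd B)
    (h : ∀ x v, A x (B x v) = B x (A x v)) {x : M} (w v : TangentSpace 𝓘(ℝ, E) x) :
    covEnd cov hA x (B x w) v + A x (covEnd cov hB x w v) =
      covEnd cov hB x (A x w) v + B x (covEnd cov hA x w v) := by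
  obtain ⟨X, hX, rfl⟩ := exists_vField w
  have h1 := covEnd_apply (cov := cov) hA (hB.mdifferentiableAt_app hX) v
  have h2 := covEnd_apply (cov := cov) hB (hA.mdifferentiableAt_app hX) v
  have h3 : A.app (B.app X) = B.app (A.app X) := funext fun y => h y (X y)
  simp only [EndField.app] at h1 h2 h3
  rw [h1, h2, covEnd_apply hA hX, covEnd_apply hB hX, map_sub, map_sub, h, h3]
  abel

/-- Differentiating `J² = -1` shows that `∇_v J` anticommutes with `J`. -/
lemma covEnd_sq {J : EndField E M} (hJ : IsSmoothEnd J) (h : ∀ x v, J x (J x v) = -v)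
    {x : M} (w v : TangentSpace 𝓘(ℝ, E) x) :
    covEnd cov hJ x (J x w) v = -J x (covEnd cov hJ x w v) := by
  obtain ⟨X, hX, rfl⟩ := exists_vField w
  have h1 := covEnd_apply (cov := cov) hJ (hJ.mdifferentiableAt_app hX) v
  have h3 : J.app (J.app X) = (-1 : ℝ) • X := funext fun y => (h y (X y)).trans (by simp)
  rw [h3, cov.isCovariantDerivativeOnUniv.smul_const _ hX] at h1
  simp only [EndField.app] at h1
  rw [h1, covEnd_apply hJ hX, map_sub, h]
  simp [sub_eq_add_neg]

/-- Without torsion, brackets are differences of covariant derivatives; by `J² = -1`, everything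
except the derivatives of `J` cancels. -/
lemma nijenhuis_eq (htor : cov.torsion = 0) {J : EndField E M} (hJ : IsSmoothEnd J)
    (h : ∀ x v, J x (J x v) = -v) {x : M} {X Y : VField E M} (hX : MDiffAt (T% X) x)
    (hY : MDiffAt (T% Y) x) :
    mlieBracket 𝓘(ℝ, E) (J.app X) (J.app Y) x
      - J x (mlieBracket 𝓘(ℝ, E) (J.app X) Y x)
      - J x (mlieBracket 𝓘(ℝ, E) X (J.app Y) x)
      - mlieBracket 𝓘(ℝ, E) X Y x =
    covEnd cov hJ x (Y x) (J x (X x)) - covEnd cov hJ x (X x) (J x (Y x))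
      + J x (covEnd cov hJ x (X x) (Y x)) - J x (covEnd cov hJ x (Y x) (X x)) := by
  have ht : ∀ {X Y : VField E M}, MDiffAt (T% X) x → MDiffAt (T% Y) x →
      cov Y x (X x) - cov X x (Y x) = mlieBracket 𝓘(ℝ, E) X Y x :=
    fun hX hY => (CovariantDerivative.torsion_eq_zero_iff cov).1 htor hX hY
  have hJX := hJ.mdifferentiableAt_app hX
  have hJY := hJ.mdifferentiableAt_app hY
  rw [← ht hJX hJY, ← ht hJX hY, ← ht hX hJY, ← ht hX hY, covEnd_apply hJ hX, covEnd_apply hJ hX,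
    covEnd_apply hJ hY, covEnd_apply hJ hY]
  simp only [map_sub, h]
  simp only [EndField.app]
  abel

lemma extDeriv₂_eq (htor : cov.torsion = 0) {β : BilinField E M}
    (hβ : ∀ x v w, β x v w = -β x w v) {x : M} {X Y Z : VField E M}
    (hX : MDiffAt (T% X) x) (hY : MDiffAt (T% Y) x) (hZ : MDiffAt (T% Z) x) :
    extDeriv₂ β X Y Z x = covDeriv₂ cov β x (X x) Y Z - covDeriv₂ cov β x (Y x) X Z
      + covDeriv₂ cov β x (Z x) X Y := by
  have ht : ∀ {X Y : VField E M}, MDiffAt (T% X) x → MDiffAt (T% Y) x →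
      cov Y x (X x) - cov X x (Y x) = mlieBracket 𝓘(ℝ, E) X Y x :=
    fun hX hY => (CovariantDerivative.torsion_eq_zero_iff cov).1 htor hX hY
  rw [extDeriv₂, ← ht hX hY, ← ht hX hZ, ← ht hY hZ]
  simp only [covDeriv₂, map_sub, _root_.sub_apply]
  rw [hβ x (Y x) (cov Z x (X x)), hβ x (X x) (cov Z x (Y x)), hβ x (X x) (cov Y x (Z x))]
  ring

/-- A complex structure whose covariant derivative satisfies `∇_{J v} J = J ∇_v J`. -/
lemma isComplexStructure_of_covEnd (htor : cov.torsion = 0) {J : EndField E M}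
    (hJ : IsSmoothEnd J) (h : ∀ x v, J x (J x v) = -v)
    (hN : ∀ x w v, covEnd cov hJ x w (J x v) = J x (covEnd cov hJ x w v)) :
    IsComplexStructure J where
  smooth := hJ
  sq := h
  integrable x X Y hX hY := by
    rw [nijenhuis_eq htor hJ h hX hY, hN, hN]
    abel

end Connection

/-! ### The Levi-Civita connection, and parallelism of `J` in the Kähler case. -/

section LeviCivita

variable {E : Type*} [NormedAddCommGroup E] [NormedSpace ℝ E] [FiniteDimensional ℝ E]
  {M : Type*} [TopologicalSpace M] [ChartedSpace E M] [IsManifold 𝓘(ℝ, E) ∞ M]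
  [RiemannianBundle (fun x : M => TangentSpace 𝓘(ℝ, E) x)]
  {cov : CovariantDerivative 𝓘(ℝ, E) E (fun x : M => TangentSpace 𝓘(ℝ, E) x)}

lemma IsOrthogonalEnd.skew {J : EndField E M} (h : IsOrthogonalEnd J)
    (hsq : ∀ x v, J x (J x v) = -v) {x : M} (v w : TangentSpace 𝓘(ℝ, E) x) :
    inner ℝ (J x v) w = -(inner ℝ v (J x w) : ℝ) := by
  rw [← h x v (J x w), hsq, inner_neg_right, neg_neg]

lemma IsOrthogonalEnd.inner_self {J : EndField E M} (h : IsOrthogonalEnd J)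
    (hsq : ∀ x v, J x (J x v) = -v) {x : M} (v : TangentSpace 𝓘(ℝ, E) x) :
    inner ℝ (J x v) v = (0 : ℝ) := by
  have h1 := h.skew hsq v v
  have h2 := real_inner_comm (J x v) v
  linarith

namespace IsLeviCivita

lemma covDeriv₂_eq_inner (hcov : IsLeviCivita cov) {β : BilinField E M} {A : EndField E M}
    (hA : IsSmoothEnd A) (hβ : ∀ x v w, β x v w = inner ℝ v (A x w)) {x : M} (v : TangentSpace 𝓘(ℝ, E) x)
    {Y Z : VField E M} (hY : MDiffAt (T% Y) x) (hZ : MDiffAt (T% Z) x) :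
    covDeriv₂ cov β x v Y Z = inner ℝ (Y x) (covEnd cov hA x (Z x) v) := by
  have h := hcov.metric x v Y (A.app Z) hY (hA.mdifferentiableAt_app hZ)
  rw [covDeriv₂, covEnd_apply hA hZ, inner_sub_right, hβ, hβ]
  simp only [hβ]
  simp only [EndField.app] at h ⊢
  linarith

lemma covDeriv₂_fundForm (hcov : IsLeviCivita cov) {J : EndField E M} (hJ : IsSmoothEnd J) {x : M}
    (v : TangentSpace 𝓘(ℝ, E) x) {Y Z : VField E M} (hY : MDiffAt (T% Y) x)
    (hZ : MDiffAt (T% Z) x) :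
    covDeriv₂ cov (fundForm J) x v Y Z = inner ℝ (covEnd cov hJ x (Y x) v) (Z x) := by
  have h := hcov.metric x v (J.app Y) Z (hJ.mdifferentiableAt_app hY) hZ
  rw [covDeriv₂, covEnd_apply hJ hY, inner_sub_left]
  simp only [fundForm_apply]
  simp only [EndField.app] at h ⊢
  linarith

lemma covEnd_skew (hcov : IsLeviCivita cov) {J : EndField E M} (hJ : IsSmoothEnd J)
    (hskew : ∀ x (v w : TangentSpace 𝓘(ℝ, E) x), inner ℝ (J x v) w = -(inner ℝ v (J x w) : ℝ))
    {x : M} (u v w : TangentSpace 𝓘(ℝ, E) x) :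
    inner ℝ (covEnd cov hJ x w v) u = -(inner ℝ w (covEnd cov hJ x u v) : ℝ) := by
  obtain ⟨W, hW, rfl⟩ := exists_vField w
  obtain ⟨U, hU, rfl⟩ := exists_vField u
  have h1 := hcov.metric x v (J.app W) U (hJ.mdifferentiableAt_app hW) hU
  have h2 := hcov.metric x v W (J.app U) hW (hJ.mdifferentiableAt_app hU)
  have h3 : (fun y => (inner ℝ (J.app W y) (U y) : ℝ)) =
      -fun y => (inner ℝ (W y) (J.app U y) : ℝ) := funext fun y => hskew y (W y) (U y)
  rw [h3, mvfderiv_neg, _root_.neg_apply, h2] at h1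
  rw [covEnd_apply hJ hW, covEnd_apply hJ hU, inner_sub_left, inner_sub_right, hskew x (cov W x v)]
  have h4 := hskew x (W x) (cov U x v)
  simp only [EndField.app] at h1 ⊢
  linarith

/-- The complex structure of a Kähler manifold is parallel. -/
lemma covEnd_eq_zero (hcov : IsLeviCivita cov) {J : EndField E M} (hJ : IsKaehler J)
    (x : M) (w v : TangentSpace 𝓘(ℝ, E) x) :
    covEnd cov hJ.complex.smooth x w v = 0 := by
  have hs := hJ.complex.smooth
  have hsq := hJ.complex.sq
  have hskew : ∀ x (v w : TangentSpace 𝓘(ℝ, E) x),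
      inner ℝ (J x v) w = -(inner ℝ v (J x w) : ℝ) := fun x => hJ.hermitian.skew hsq
  set N := covEnd cov hs x with hN
  let F : TangentSpace 𝓘(ℝ, E) x → TangentSpace 𝓘(ℝ, E) x → TangentSpace 𝓘(ℝ, E) x → ℝ :=
    fun u y z => inner ℝ (N y u) z
  have hF : ∀ u y z, F u y z = inner ℝ (N y u) z := fun _ _ _ => rfl
  have hanti : ∀ u y z, F u y z = -F u z y := fun u y z => by
    rw [hF, hF, hcov.covEnd_skew hs hskew, real_inner_comm]
  have hJJ : ∀ u y z, F u (J x y) z = F u y (J x z) := fun u y z => by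
    rw [hF, hF, hN, covEnd_sq hs hsq, inner_neg_left, hskew, neg_neg]
  have hneg3 : ∀ u y z, F u y (-z) = -F u y z := fun u y z => by
    rw [hF, hF, inner_neg_right]
  have hclosed : ∀ u y z, F u y z + F y z u + F z u y = 0 := fun u y z => by
    obtain ⟨X, hX, rfl⟩ := exists_vField u
    obtain ⟨Y, hY, rfl⟩ := exists_vField y
    obtain ⟨Z, hZ, rfl⟩ := exists_vField z
    have h := hJ.closed x X Y Z hX hY hZ
    rw [extDeriv₂_eq hcov.torsion (fun x v w => by
      rw [fundForm_apply, fundForm_apply, hskew, real_inner_comm]) hX hY hZ,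
      hcov.covDeriv₂_fundForm hs _ hY hZ, hcov.covDeriv₂_fundForm hs _ hX hZ,
      hcov.covDeriv₂_fundForm hs _ hX hY] at h
    have h' := hanti (Y x) (X x) (Z x)
    simp only [hF] at h' ⊢
    linarith
  have hint : ∀ u y z, F (J x u) y z - F (J x y) u z - F y u (J x z) + F u y (J x z) = 0 :=
    fun u y z => by
    obtain ⟨X, hX, rfl⟩ := exists_vField u
    obtain ⟨Y, hY, rfl⟩ := exists_vField y
    have h := hJ.complex.integrable x X Y hX hY
    rw [nijenhuis_eq hcov.torsion hs hsq hX hY] at h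
    have h := congrArg (fun t => (inner ℝ t z : ℝ)) h
    simp only [inner_sub_left, inner_add_left, inner_zero_left, hskew] at h
    simp only [hF]
    linarith
  -- The classical identity for `∇J`: closedness at `(u, y, z)`, minus closedness at `(u, Jy, Jz)`,
  -- plus the Nijenhuis identity for `(y, z)` paired with `Ju`, leaves `2 F u y z = 0`.
  have hzero : ∀ u y z, F u y z = 0 := fun u y z => by
    have e1 := hclosed u y z
    have e2 := hclosed u (J x y) (J x z)
    have e3 := hint y z (J x u)
    rw [hJJ u y (J x z), hsq, hneg3] at e2
    rw [hsq, hneg3, hneg3] at e3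
    have e4 := hanti (J x z) u (J x y)
    have e5 := hJJ (J x z) y u
    have e6 := hanti z u y
    have e7 := hJJ (J x y) z u
    linarith
  have h := hzero v w (N w v)
  rwa [hF, inner_self_eq_zero] at h

end IsLeviCivita

end LeviCivita

/-! ### Integrability of the structures given by polynomials in `sharp ψ`. -/

section Hamiltonian

variable {E : Type*} [NormedAddCommGroup E] [NormedSpace ℝ E] [FiniteDimensional ℝ E]
  {M : Type*} [TopologicalSpace M] [ChartedSpace E M] [IsManifold 𝓘(ℝ, E) ∞ M]
  [RiemannianBundle (fun x : M => TangentSpace 𝓘(ℝ, E) x)]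
  [IsContMDiffRiemannianBundle 𝓘(ℝ, E) ∞ E (fun x : M => TangentSpace 𝓘(ℝ, E) x)]
  {cov : CovariantDerivative 𝓘(ℝ, E) E (fun x : M => TangentSpace 𝓘(ℝ, E) x)}
  {J : EndField E M} {ψ : BilinField E M} {σ : M → ℝ}

lemma IsTwoForm.sharp_skew {β : BilinField E M} (hβ : IsTwoForm β) {x : M}
    (v w : TangentSpace 𝓘(ℝ, E) x) :
    inner ℝ (sharp β x v) w = -(inner ℝ v (sharp β x w) : ℝ) := by
  rw [real_inner_comm, inner_sharp, inner_sharp, hβ.swap]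

namespace IsHamiltonian

lemma sharp_comm (hψ : IsHamiltonian cov J ψ σ) (hsq : ∀ x v, J x (J x v) = -v)
    (horth : IsOrthogonalEnd J) (x : M) (v : TangentSpace 𝓘(ℝ, E) x) :
    sharp ψ x (J x v) = J x (sharp ψ x v) := by
  refine ext_inner_left ℝ fun u => ?_
  rw [inner_sharp, ← neg_eq_iff_eq_neg.2 (horth.skew hsq u (sharp ψ x v)), inner_sharp,
    ← hψ.oneOne x u, hsq, map_neg]

lemma inner_covEnd_sharp (hψ : IsHamiltonian cov J ψ σ) (hcov : IsLeviCivita cov) {x : M}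
    (u v w : TangentSpace 𝓘(ℝ, E) x) :
    inner ℝ u (covEnd cov hψ.form.isSmoothEnd_sharp x w v) =
      1 / 2 * (
        (mvfderiv 𝓘(ℝ, E) σ x u * inner ℝ (J x v) w - mvfderiv 𝓘(ℝ, E) σ x w * inner ℝ (J x v) u)
        + (mvfderiv 𝓘(ℝ, E) σ x (J x u) * inner ℝ v w
          - mvfderiv 𝓘(ℝ, E) σ x (J x w) * inner ℝ v u) : ℝ) := by
  obtain ⟨U, hU, rfl⟩ := exists_vField u
  obtain ⟨W, hW, rfl⟩ := exists_vField w
  rw [← hcov.covDeriv₂_eq_inner hψ.form.isSmoothEnd_sharp (fun x v w => (inner_sharp ψ x v w).symm)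
    v hU hW, hψ.eqn x v U W hU hW]
  ring

/-- An orthogonal almost complex structure given pointwise by polynomials in the endomorphism of
a Hamiltonian form is integrable. -/
lemma isComplexStructure_of_aeval (hψ : IsHamiltonian cov J ψ σ) (hcov : IsLeviCivita cov)
    (hJsq : ∀ x v, J x (J x v) = -v) (hJorth : IsOrthogonalEnd J) {S : EndField E M}
    (hS : IsSmoothEnd S) (hsq : ∀ x v, S x (S x v) = -v) (horth : IsOrthogonalEnd S)
    (q : M → Polynomial ℝ)
    (hSq : ∀ x v, S x v = Polynomial.aeval
      ((sharp ψ x).toLinearMap : Module.End ℝ (TangentSpace 𝓘(ℝ, E) x)) (q x) v) :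
    IsComplexStructure S := by
  refine isComplexStructure_of_covEnd hcov.torsion hS hsq fun x w v => ?_
  have hA := hψ.form.isSmoothEnd_sharp
  have hAS : ∀ x v, sharp ψ x (S x v) = S x (sharp ψ x v) := fun x v => by
    rw [hSq, hSq]
    exact apply_aeval_of_commute (S := (sharp ψ x).toLinearMap) (fun _ => rfl) (q x) v
  have hJS : ∀ v, J x (S x v) = S x (J x v) := fun v => by
    rw [hSq, hSq]
    exact apply_aeval_of_commute (S := (J x).toLinearMap)
      (fun v => (hψ.sharp_comm hJsq hJorth x v).symm) (q x) v
  set H := covEnd cov hA x with hH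
  set N := covEnd cov hS x with hN
  have c1 : ∀ w v, sharp ψ x (N w v) = N (sharp ψ x w) v + S x (H w v) - H (S x w) v :=
    fun w v => eq_sub_of_add_eq' (covEnd_commute hA hS hAS w v)
  have c2 : ∀ w v, N (S x w) v = -S x (N w v) := covEnd_sq hS hsq
  -- The only use of the Hamiltonian equation. Each term of `∇A` is `dσ` of one vector times an
  -- inner product of two others; since `S` is orthogonal, skew and commutes with `J`, the terms
  -- cancel in pairs.
  have c3 : ∀ w v, H (S x w) (S x v) - S x (H w (S x v)) - S x (H (S x w) v) - H w v = 0 := by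
    intro w v
    refine ext_inner_left ℝ fun u => ?_
    have hs := fun a b : TangentSpace 𝓘(ℝ, E) x => horth.skew hsq a b
    have hs' : ∀ a b : TangentSpace 𝓘(ℝ, E) x, inner ℝ a (S x b) = -(inner ℝ (S x a) b : ℝ) :=
      fun a b => by rw [hs, neg_neg]
    rw [inner_sub_right, inner_sub_right, inner_sub_right, hs' u, hs' u, inner_zero_right]
    simp only [hH, hψ.inner_covEnd_sharp hcov]
    have o1 := horth x (J x v) w
    have o2 := horth x (J x v) u
    have o3 := horth x v w
    have o4 := horth x v u
    rw [← hJS] at o1 o2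
    rw [o1, o2, o3, o4, hs' (J x v) w, hs' (J x v) u, hs' v w, hs' v u, ← hJS v]
    ring
  -- `T = ∇_{Sv} S - S ∇_v S` for the fixed direction `v`; by `c1`, its commutator with `A` is the
  -- expression in `c3`.
  let T : Module.End ℝ (TangentSpace 𝓘(ℝ, E) x) :=
    { toFun := fun w => N w (S x v) - S x (N w v)
      map_add' := fun w w' => by simp only [map_add, _root_.add_apply]; abel
      map_smul' := fun c w => by
        simp only [map_smul, _root_.smul_apply, RingHom.id_apply, smul_sub] }
  have hT : ∀ w, T w = N w (S x v) - S x (N w v) := fun _ => rfl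
  have hTA : ∀ w, T (sharp ψ x w) = sharp ψ x (T w) := fun w => by
    have h := c3 w v
    rw [hT, hT, map_sub, hAS, c1, c1, map_sub, map_add, hsq]
    rw [← sub_eq_zero, ← h]
    abel
  have hTS : T (S x w) = S x (T w) := by
    rw [hSq, hSq]
    exact apply_aeval_of_commute hTA (q x) w
  -- `T` also anticommutes with `S`, because both `∇_{Sv} S` and `∇_v S` do; hence `S T = 0`.
  have hTS' : T (S x w) = -S x (T w) := by
    rw [hT, hT, c2, c2, map_sub, map_neg]
    abel
  have h0 : S x (T w) = 0 := by
    have h2 : (2 : ℝ) • S x (T w) = 0 := by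
      rw [two_smul]; exact eq_neg_iff_add_eq_zero.1 (hTS.symm.trans hTS')
    exact (smul_eq_zero.1 h2).resolve_left two_ne_zero
  have h1 : T w = 0 := by
    have := hsq x (T w)
    rw [h0, map_zero] at this
    exact neg_eq_zero.1 this.symm
  exact sub_eq_zero.1 h1

end IsHamiltonian

end Hamiltonian

/-! ### Involutivity of `T^{1,0}`. -/

section Frobenius

variable {E : Type*} [NormedAddCommGroup E] [NormedSpace ℝ E] [FiniteDimensional ℝ E]
  {M : Type*} [TopologicalSpace M] [ChartedSpace E M] [IsManifold 𝓘(ℝ, E) ∞ M]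

lemma cvec_mem_eigenspace_I {x : M}
    {S : TangentSpace 𝓘(ℝ, E) x →L[ℝ] TangentSpace 𝓘(ℝ, E) x} (hsq : ∀ v, S (S v) = -v)
    {v w : TangentSpace 𝓘(ℝ, E) x} :
    cvec v w ∈ Module.End.eigenspace (cEnd S) Complex.I ↔ w = -S v := by
  rw [Module.End.mem_eigenspace_iff, cvec, cEnd, baseChange_apply_eq_smul_iff]
  simp only [Complex.I_re, Complex.I_im, zero_smul, one_smul, zero_sub, zero_add,
    ContinuousLinearMap.coe_coe]
  constructor
  · rintro ⟨h, -⟩; rw [h, neg_neg]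
  · rintro rfl; simp [hsq]

variable [RiemannianBundle (fun x : M => TangentSpace 𝓘(ℝ, E) x)]

/-- The bundle `T^{1,0}` of a complex structure is involutive. -/
lemma IsComplexStructure.isInvolutive_holTangent {S : EndField E M} (hS : IsComplexStructure S) :
    IsInvolutive (holTangent S) := by
  intro U hU X Y X' Y' hX hY hX' hY' hXY hXY' x hx
  have hmem : ∀ y (v w : TangentSpace 𝓘(ℝ, E) y), cvec v w ∈ holTangent S y ↔ w = -S y v :=
    fun y v w => cvec_mem_eigenspace_I (hS.sq y)
  have hUx : U ∈ nhds x := hU.mem_nhds hx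
  have hXd : MDiffAt (T% X) x := (hX.contMDiffAt hUx).mdifferentiableAt (by simp)
  have hXd' : MDiffAt (T% X') x := (hX'.contMDiffAt hUx).mdifferentiableAt (by simp)
  have hYX : Y =ᶠ[nhds x] (-1 : ℝ) • S.app X := by
    filter_upwards [hUx] with y hy
    exact ((hmem y _ _).1 (hXY y hy)).trans (neg_one_smul ℝ (S y (X y))).symm
  have hYX' : Y' =ᶠ[nhds x] (-1 : ℝ) • S.app X' := by
    filter_upwards [hUx] with y hy
    exact ((hmem y _ _).1 (hXY' y hy)).trans (neg_one_smul ℝ (S y (X' y))).symm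
  have hSX := hS.smooth.mdifferentiableAt_app hXd
  have hSX' := hS.smooth.mdifferentiableAt_app hXd'
  have e1 : mlieBracket 𝓘(ℝ, E) Y Y' x = mlieBracket 𝓘(ℝ, E) (S.app X) (S.app X') x := by
    rw [hYX.mlieBracket_vectorField_eq hYX', mlieBracket_const_smul_left hSX,
      mlieBracket_const_smul_right hSX', smul_smul, neg_one_mul, neg_neg, one_smul]
  have e2 : mlieBracket 𝓘(ℝ, E) X Y' x = (-1 : ℝ) • mlieBracket 𝓘(ℝ, E) X (S.app X') x := by
    rw [(Filter.EventuallyEq.refl _ X).mlieBracket_vectorField_eq hYX',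
      mlieBracket_const_smul_right hSX']
  have e3 : mlieBracket 𝓘(ℝ, E) Y X' x = (-1 : ℝ) • mlieBracket 𝓘(ℝ, E) (S.app X) X' x := by
    rw [hYX.mlieBracket_vectorField_eq (Filter.EventuallyEq.refl _ X'),
      mlieBracket_const_smul_left hSX]
  -- A section of `T^{1,0}` is `X - i SX`. The bracket of two such sections has this form again
  -- exactly when `S` applied to the Nijenhuis expression vanishes.
  have h := congrArg (S x) (hS.integrable x X X' hXd hXd')
  simp only [map_sub, hS.sq, map_zero] at h
  rw [hmem, e1, e2, e3, map_sub, ← sub_eq_zero, ← neg_eq_zero, ← h]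
  module

end Frobenius

/-! ### The wedge product of a `1`-form and a `2`-form. -/

section WedgeForm

variable {V : Type*} [AddCommGroup V] [Module ℝ V]

/-- The `3`-form `c • α ∧ β` for a linear form `α` and an alternating bilinear form `β`. -/
noncomputable def wedgeForm (c : ℝ) (α : V →ₗ[ℝ] ℝ) (β : V →ₗ[ℝ] V →ₗ[ℝ] ℝ) (hβ : ∀ v, β v v = 0) :
    V [⋀^Fin 3]→ₗ[ℝ] ℝ where
  toFun u := c * (α (u 0) * β (u 1) (u 2) - α (u 1) * β (u 0) (u 2) + α (u 2) * β (u 0) (u 1))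
  map_update_add' := by
    intro inst u i v w
    obtain rfl : inst = instDecidableEqFin 3 := Subsingleton.elim _ _
    fin_cases i <;> simp [Function.update] <;> ring
  map_update_smul' := by
    intro inst u i r v
    obtain rfl : inst = instDecidableEqFin 3 := Subsingleton.elim _ _
    fin_cases i <;> simp [Function.update] <;> ring
  map_eq_zero_of_eq' := by
    intro u i j h hij
    have hneg : ∀ v w, β v w = -β w v := fun v w => by
      have h := hβ (v + w)
      simp only [map_add, LinearMap.add_apply, hβ] at h
      linarith
    fin_cases i <;> fin_cases j <;> simp at h hij ⊢ <;> right
    · rw [h, hβ]; ring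
    · rw [h, hneg (u 1) (u 2), hβ]; ring
    · rw [h, hβ]; ring
    · rw [h, hβ]; ring
    · rw [← h, hneg (u 2) (u 1), hβ]; ring
    · rw [h, hβ]; ring

end WedgeForm

/-! ### The conformal Killing equation for the shifted form. -/

section ConformalKilling

variable {E : Type*} [NormedAddCommGroup E] [NormedSpace ℝ E] [FiniteDimensional ℝ E]
  {M : Type*} [TopologicalSpace M] [ChartedSpace E M] [IsManifold 𝓘(ℝ, E) ∞ M]
  [RiemannianBundle (fun x : M => TangentSpace 𝓘(ℝ, E) x)]
  [IsContMDiffRiemannianBundle 𝓘(ℝ, E) ∞ E (fun x : M => TangentSpace 𝓘(ℝ, E) x)]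
  {cov : CovariantDerivative 𝓘(ℝ, E) E (fun x : M => TangentSpace 𝓘(ℝ, E) x)}
  {J : EndField E M} {ψ : BilinField E M} {σ : M → ℝ}

lemma mdifferentiableAt_inner {x : M} {Y Z : VField E M} (hY : MDiffAt (T% Y) x)
    (hZ : MDiffAt (T% Z) x) : MDiffAt (fun y => (inner ℝ (Y y) (Z y) : ℝ)) x :=
  MDifferentiableAt.inner_bundle (IB := 𝓘(ℝ, E)) (F := E)
    (E := fun x : M => TangentSpace 𝓘(ℝ, E) x) (b := fun y => y) hY hZ

/-- Because `ω` is parallel, the shift contributes only `-½ dσ(v) ω`. This is the term missing from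
`∇_v ψ` for the first bracket to be `v ⌟ (dσ ∧ ω)`. -/
lemma IsHamiltonian.covDeriv₂_shiftedForm (hψ : IsHamiltonian cov J ψ σ) (hcov : IsLeviCivita cov)
    (hJ : IsKaehler J) {x : M} (v : TangentSpace 𝓘(ℝ, E) x) {Y Z : VField E M}
    (hY : MDiffAt (T% Y) x) (hZ : MDiffAt (T% Z) x) :
    covDeriv₂ cov (shiftedForm J ψ σ) x v Y Z =
      -(1 / 2) * (mvfderiv 𝓘(ℝ, E) σ x v * inner ℝ (J x (Y x)) (Z x)
          - mvfderiv 𝓘(ℝ, E) σ x (Y x) * inner ℝ (J x v) (Z x)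
          + mvfderiv 𝓘(ℝ, E) σ x (Z x) * inner ℝ (J x v) (Y x))
        + 1 / 2 * (mvfderiv 𝓘(ℝ, E) σ x (J x (Y x)) * inner ℝ v (Z x)
          - mvfderiv 𝓘(ℝ, E) σ x (J x (Z x)) * inner ℝ v (Y x)) := by
  have h1 := hψ.eqn x v Y Z hY hZ
  have h2 := hcov.covDeriv₂_fundForm hJ.complex.smooth v hY hZ
  rw [hcov.covEnd_eq_zero hJ, inner_zero_left] at h2
  have d1 : MDiffAt (fun y => ψ y (Y y) (Z y)) x := by
    simp only [← inner_sharp]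
    exact mdifferentiableAt_inner hY (hψ.form.isSmoothEnd_sharp.mdifferentiableAt_app hZ)
  have d2 : MDiffAt (fun y => fundForm J y (Y y) (Z y)) x :=
    mdifferentiableAt_inner (hJ.complex.smooth.mdifferentiableAt_app hY) hZ
  have d3 : MDiffAt σ x := (hψ.smooth x).mdifferentiableAt (by simp)
  have h3 : (fun y => shiftedForm J ψ σ y (Y y) (Z y)) =
      (fun y => ψ y (Y y) (Z y)) - (fun _ => (1 / 2 : ℝ)) *
        (σ * fun y => fundForm J y (Y y) (Z y)) := by
    funext y
    simp [shiftedForm]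
    ring
  have d4 : MDiffAt (σ * fun y => fundForm J y (Y y) (Z y)) x := d3.mul d2
  simp only [covDeriv₂] at h1 h2 ⊢
  rw [h3, mvfderiv_sub d1 (mdifferentiableAt_const.mul d4),
    mvfderiv_mul mdifferentiableAt_const d4, mvfderiv_mul d3 d2, mvfderiv_const]
  simp only [shiftedForm, _root_.sub_apply, _root_.smul_apply, smul_eq_mul, _root_.add_apply,
    _root_.zero_apply, mul_zero, add_zero]
    at h1 h2 ⊢
  rw [← fundForm_apply J x (Y x) (Z x)]
  linear_combination h1 - σ x / 2 * h2

lemma IsHamiltonian.isConformalKilling_shiftedForm {m : ℕ} (hdim : finrank ℝ E = 2 * m)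
    (hψ : IsHamiltonian cov J ψ σ) (hcov : IsLeviCivita cov) (hJ : IsKaehler J) :
    IsConformalKilling cov (shiftedForm J ψ σ) := by
  have hself := fun x v => hJ.hermitian.inner_self hJ.complex.sq (x := x) v
  -- The witnesses are `τ = -(3/2) dσ ∧ ω` and `K = -((n-1)/2) dσ ∘ J`, normalised to absorb the
  -- factors `1/3` and `1/(n-1)`; the latter is legitimate because `n` is even.
  refine ⟨hψ.form.shiftedForm hJ.complex.smooth hself hψ.smooth,
    fun x => wedgeForm (-(3 / 2)) (mvfderiv 𝓘(ℝ, E) σ x).toLinearMap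
      ((innerₗ (TangentSpace 𝓘(ℝ, E) x)).comp (J x).toLinearMap) (hself x),
    fun x => (-((finrank ℝ E : ℝ) - 1) / 2) • (mvfderiv 𝓘(ℝ, E) σ x).comp (J x),
    fun x v Y Z hY hZ => ?_⟩
  have hn : ((finrank ℝ E : ℝ) - 1) ≠ 0 := by
    rw [hdim, sub_ne_zero]
    exact_mod_cast (by omega : 2 * m ≠ 1)
  rw [hψ.covDeriv₂_shiftedForm hcov hJ v hY hZ]
  simp only [wedgeForm, AlternatingMap.coe_mk, MultilinearMap.coe_mk, LinearMap.comp_apply,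
    ContinuousLinearMap.coe_coe, innerₗ_apply_apply, ContinuousLinearMap.comp_apply,
    _root_.smul_apply, smul_eq_mul, Matrix.cons_val_zero, Matrix.cons_val_one, Matrix.cons_val]
  field_simp
  ring

lemma exists_ne_zero_inner_eq_zero {V : Type*} [NormedAddCommGroup V] [InnerProductSpace ℝ V]
    [FiniteDimensional ℝ V] (h : 2 < finrank ℝ V) (v w : V) :
    ∃ u : V, u ≠ 0 ∧ inner ℝ v u = (0 : ℝ) ∧ inner ℝ w u = (0 : ℝ) := by
  classical
  set K : Submodule ℝ V := Submodule.span ℝ ((({v, w} : Finset V)) : Set V) with hK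
  have h1 : finrank ℝ K ≤ 2 := (finrank_span_finset_le_card _).trans Finset.card_le_two
  have h2 := K.finrank_add_finrank_orthogonal
  have h3 : Kᗮ ≠ ⊥ := by
    intro h0
    rw [h0, finrank_bot] at h2
    omega
  obtain ⟨u, hu, hu0⟩ := Submodule.exists_mem_ne_zero_of_ne_bot h3
  rw [Submodule.mem_orthogonal] at hu
  exact ⟨u, hu0, hu v (Submodule.subset_span (by simp)), hu w (Submodule.subset_span (by simp))⟩

lemma IsHamiltonian.isClosedForm_shiftedForm_iff {m : ℕ} (hdim : finrank ℝ E = 2 * m) (hm : 2 ≤ m)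
    (hψ : IsHamiltonian cov J ψ σ) (hcov : IsLeviCivita cov) (hJ : IsKaehler J) :
    IsClosedForm (shiftedForm J ψ σ) ↔ IsParallelForm cov (shiftedForm J ψ σ) := by
  have hself := fun x v => hJ.hermitian.inner_self hJ.complex.sq (x := x) v
  have hform := hψ.form.shiftedForm hJ.complex.smooth hself hψ.smooth
  have halt : ∀ x v w, shiftedForm J ψ σ x v w = -shiftedForm J ψ σ x w v :=
    fun x v w => (hform.swap w v).symm
  have hskew : ∀ x (v w : TangentSpace 𝓘(ℝ, E) x),
      inner ℝ (J x v) w = -(inner ℝ v (J x w) : ℝ) := fun x => hJ.hermitian.skew hJ.complex.sq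
  constructor
  · intro hc
    have hσ : ∀ x (v : TangentSpace 𝓘(ℝ, E) x), mvfderiv 𝓘(ℝ, E) σ x v = 0 := by
      intro x v
      -- Here `m ≥ 2` enters. With `u` orthogonal to `v` and `Jv`, evaluating `dφ`, a multiple of
      -- `dσ ∧ ω`, on `(v, u, Ju)` leaves only `dσ(v) |u|²`.
      obtain ⟨u, hu0, hu1, hu2⟩ := exists_ne_zero_inner_eq_zero
        (V := TangentSpace 𝓘(ℝ, E) x) (show 2 < finrank ℝ E by omega) v (J x v)
      obtain ⟨X, hX, hXv⟩ := exists_vField v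
      obtain ⟨Y, hY, hYu⟩ := exists_vField u
      obtain ⟨Z, hZ, hZu⟩ := exists_vField (J x u)
      have h := hc x X Y Z hX hY hZ
      rw [extDeriv₂_eq hcov.torsion halt hX hY hZ, hψ.covDeriv₂_shiftedForm hcov hJ _ hY hZ,
        hψ.covDeriv₂_shiftedForm hcov hJ _ hX hZ, hψ.covDeriv₂_shiftedForm hcov hJ _ hX hY,
        hXv, hYu, hZu] at h
      have e1 : inner ℝ v (J x u) = (0 : ℝ) := by
        rw [← neg_eq_zero, ← hskew, hu2]
      have e2 : inner ℝ (J x u) v = (0 : ℝ) := by rw [real_inner_comm, e1]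
      have e3 : inner ℝ u v = (0 : ℝ) := by rw [real_inner_comm, hu1]
      have e4 : inner ℝ (J x v) (J x u) = (0 : ℝ) := by rw [hJ.hermitian, hu1]
      have e5 : inner ℝ (J x u) (J x u) = (inner ℝ u u : ℝ) := hJ.hermitian x u u
      have e6 : inner ℝ u (J x u) = (0 : ℝ) := by rw [real_inner_comm, hself]
      simp only [hJ.complex.sq, inner_neg_left, e1, e2, e3, e4, e5, e6, hu1, hu2, hself] at h
      have h' : mvfderiv 𝓘(ℝ, E) σ x v * inner ℝ u u = 0 := by linarith
      exact (mul_eq_zero.1 h').resolve_right (inner_self_ne_zero.2 hu0)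
    intro x v Y Z hY hZ
    rw [hψ.covDeriv₂_shiftedForm hcov hJ v hY hZ]
    simp only [hσ]
    ring
  · intro hp x X Y Z hX hY hZ
    rw [extDeriv₂_eq hcov.torsion halt hX hY hZ, hp x _ Y Z hY hZ, hp x _ X Z hX hZ,
      hp x _ X Y hX hY]
    ring

end ConformalKilling

/-! ### Smoothness of polynomials in an endomorphism field with smooth coefficients. -/

section PolyEnd

open Polynomial

variable {E : Type*} [NormedAddCommGroup E] [NormedSpace ℝ E]
  {M : Type*} [TopologicalSpace M] [ChartedSpace E M]

/-- A polynomial, depending on the point, in a field of endomorphisms. -/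
noncomputable def polyEnd (B : EndField E M) (q : M → ℝ[X]) : EndField E M := fun x =>
  aeval (B x) (q x)

lemma toLinearMap_polyEnd (B : EndField E M) (q : M → ℝ[X]) (x : M) :
    (polyEnd B q x).toLinearMap =
      aeval ((B x).toLinearMap : Module.End ℝ (TangentSpace 𝓘(ℝ, E) x)) (q x) :=
  (aeval_algHom_apply (R := ℝ) (A := TangentSpace 𝓘(ℝ, E) x →L[ℝ] TangentSpace 𝓘(ℝ, E) x)
    (B := Module.End ℝ (TangentSpace 𝓘(ℝ, E) x))
    ({ (ContinuousLinearMap.toLinearMapRingHom :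
        (TangentSpace 𝓘(ℝ, E) x →L[ℝ] TangentSpace 𝓘(ℝ, E) x) →+* _) with
      commutes' := fun _ => rfl } : _ →ₐ[ℝ] _) (B x) (q x)).symm

lemma polyEnd_apply (B : EndField E M) (q : M → ℝ[X]) (x : M) (v : TangentSpace 𝓘(ℝ, E) x) :
    polyEnd B q x v =
      aeval ((B x).toLinearMap : Module.End ℝ (TangentSpace 𝓘(ℝ, E) x)) (q x) v :=
  LinearMap.congr_fun (toLinearMap_polyEnd B q x) v

variable [IsManifold 𝓘(ℝ, E) ∞ M] {B : EndField E M} {p q : M → ℝ[X]}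

lemma isSmoothEnd_polyEnd_add (hp : IsSmoothEnd (polyEnd B p)) (hq : IsSmoothEnd (polyEnd B q)) :
    IsSmoothEnd (polyEnd B fun x => p x + q x) := by
  convert hp.add hq using 2 with x
  exact map_add _ _ _

lemma isSmoothEnd_polyEnd_mul (hp : IsSmoothEnd (polyEnd B p)) (hq : IsSmoothEnd (polyEnd B q)) :
    IsSmoothEnd (polyEnd B fun x => p x * q x) := by
  convert hp.comp hq using 2 with x
  exact map_mul _ _ _

lemma isSmoothEnd_polyEnd_C {f : M → ℝ} (hf : ContMDiff 𝓘(ℝ, E) 𝓘(ℝ, ℝ) ∞ f) :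
    IsSmoothEnd (polyEnd B fun x => C (f x)) := by
  have h : (polyEnd B fun x => C (f x)) =
      fun x => f x • ContinuousLinearMap.id ℝ (TangentSpace 𝓘(ℝ, E) x) := by
    funext x
    ext v
    rw [polyEnd_apply, aeval_C]
    rfl
  rw [h]
  exact IsSmoothEnd.smul hf isSmoothEnd_id

lemma isSmoothEnd_polyEnd_X (hB : IsSmoothEnd B) : IsSmoothEnd (polyEnd B fun _ => X) := by
  rwa [show (polyEnd B fun _ => X) = B from funext fun x => aeval_X (B x)]

lemma isSmoothEnd_polyEnd_sum {ι : Type*} (s : Finset ι) {p : ι → M → ℝ[X]}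
    (hp : ∀ i ∈ s, IsSmoothEnd (polyEnd B (p i))) :
    IsSmoothEnd (polyEnd B fun x => ∑ i ∈ s, p i x) := by
  classical
  induction s using Finset.induction_on with
  | empty => simpa using isSmoothEnd_polyEnd_C (B := B) (f := fun _ => 0) contMDiff_const
  | insert i s hi ih =>
    simp only [Finset.sum_insert hi]
    exact isSmoothEnd_polyEnd_add (hp i (Finset.mem_insert_self i s))
      (ih fun j hj => hp j (Finset.mem_insert_of_mem hj))

lemma isSmoothEnd_polyEnd_prod {ι : Type*} (s : Finset ι) {p : ι → M → ℝ[X]}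
    (hp : ∀ i ∈ s, IsSmoothEnd (polyEnd B (p i))) :
    IsSmoothEnd (polyEnd B fun x => ∏ i ∈ s, p i x) := by
  classical
  induction s using Finset.induction_on with
  | empty => simpa using isSmoothEnd_polyEnd_C (B := B) (f := fun _ => 1) contMDiff_const
  | insert i s hi ih =>
    simp only [Finset.prod_insert hi]
    exact isSmoothEnd_polyEnd_mul (hp i (Finset.mem_insert_self i s))
      (ih fun j hj => hp j (Finset.mem_insert_of_mem hj))

variable {m : ℕ} {a : Fin m → M → ℝ}

lemma isSmoothEnd_projPoly (hB : IsSmoothEnd B) (hpos : ∀ x μ, 0 < a μ x)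
    (hinj : ∀ x, Function.Injective fun μ => a μ x)
    (hsm : ∀ μ, ContMDiff 𝓘(ℝ, E) 𝓘(ℝ, ℝ) ∞ (a μ)) (μ : Fin m) :
    IsSmoothEnd (polyEnd B fun x => projPoly (fun ν => a ν x) μ) := by
  refine isSmoothEnd_polyEnd_prod _ fun ν hν => isSmoothEnd_polyEnd_mul
    (isSmoothEnd_polyEnd_C ?_) (isSmoothEnd_polyEnd_add ?_ (isSmoothEnd_polyEnd_C ((hsm ν).pow 2)))
  · exact (((hsm ν).pow 2).sub ((hsm μ).pow 2)).inv₀ fun x =>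
      sq_sub_sq_ne_zero (hpos x) (hinj x) (Finset.ne_of_mem_erase hν)
  · simp only [sq]
    exact isSmoothEnd_polyEnd_mul (isSmoothEnd_polyEnd_X hB) (isSmoothEnd_polyEnd_X hB)

lemma isSmoothEnd_structPoly (hB : IsSmoothEnd B) (hpos : ∀ x μ, 0 < a μ x)
    (hinj : ∀ x, Function.Injective fun μ => a μ x)
    (hsm : ∀ μ, ContMDiff 𝓘(ℝ, E) 𝓘(ℝ, ℝ) ∞ (a μ)) (s : Fin m → Bool) :
    IsSmoothEnd (polyEnd B fun x => structPoly (fun ν => a ν x) s) := by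
  refine isSmoothEnd_polyEnd_sum _ fun μ _ => isSmoothEnd_polyEnd_mul
    (isSmoothEnd_polyEnd_C ?_) (isSmoothEnd_polyEnd_mul (isSmoothEnd_polyEnd_X hB)
      (isSmoothEnd_projPoly hB hpos hinj hsm μ))
  have h := (hsm μ).inv₀ fun x => (hpos x μ).ne'
  cases s μ
  · exact h.neg
  · exact h

end PolyEnd

/-! ### Pointwise eigenbases with ordered eigenvalue functions. -/

section EigenSystem

variable {E : Type*} [NormedAddCommGroup E] [NormedSpace ℝ E] [FiniteDimensional ℝ E]
  {M : Type*} [TopologicalSpace M] [ChartedSpace E M] {m : ℕ}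

/-- The numbers `± i a μ x` are the eigenvalues of `B x`, and `0 < a 0 x < a 1 x < ...`. -/
structure EigenSystem (B : EndField E M) (a : Fin m → M → ℝ) : Prop where
  pos : ∀ x μ, 0 < a μ x
  strictMono : ∀ x, StrictMono fun μ => a μ x
  exists_basis : ∀ x, ∃ b, IsEigenbasis (V := TangentSpace 𝓘(ℝ, E) x) (B x).toLinearMap
    (fun μ => a μ x) b

namespace EigenSystem

variable {B : EndField E M} {a : Fin m → M → ℝ}

lemma injective (h : EigenSystem B a) (x : M) : Function.Injective fun μ => a μ x :=
  (h.strictMono x).injective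

variable [IsManifold 𝓘(ℝ, E) ∞ M]

lemma contMDiff (h : EigenSystem B a) (hB : IsSmoothEnd B) (μ : Fin m) :
    ContMDiff 𝓘(ℝ, E) 𝓘(ℝ, ℝ) ∞ (a μ) := by
  refine contMDiff_eigenvalue hB h.pos h.strictMono (fun x τ => ?_) μ
  obtain ⟨b, hb⟩ := h.exists_basis x
  have : FiniteDimensional ℝ (TangentSpace 𝓘(ℝ, E) x) := inferInstanceAs (FiniteDimensional ℝ E)
  exact hb.eval_charpoly τ

end EigenSystem

end EigenSystem

/-! ### The eigendistributions and their complex structures on the manifold. -/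

section Riemannian

variable {E : Type*} [NormedAddCommGroup E] [NormedSpace ℝ E] [FiniteDimensional ℝ E]
  {M : Type*} [TopologicalSpace M] [ChartedSpace E M] [IsManifold 𝓘(ℝ, E) ∞ M]
  [RiemannianBundle (fun x : M => TangentSpace 𝓘(ℝ, E) x)]
  [IsContMDiffRiemannianBundle 𝓘(ℝ, E) ∞ E (fun x : M => TangentSpace 𝓘(ℝ, E) x)]
  {m : ℕ} {β : BilinField E M} {a : Fin m → M → ℝ}

lemma IsTwoForm.exists_eigenSystem (hβ : IsTwoForm β) (hdim : finrank ℝ E = 2 * m)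
    (hnd : IsNondegenerate β) (hdist : HasDistinctEigenvalues β) :
    ∃ a : Fin m → M → ℝ, EigenSystem (sharp β) a ∧ ∀ x (z : ℂ),
      (cEnd (sharp β x)).HasEigenvalue z ↔ ∃ μ t, z = eigVal (a μ x) t := by
  have hinj : ∀ x v, sharp β x v = 0 → v = 0 := fun x v hv => hnd x v fun w => by
    rw [← neg_eq_zero, hβ.swap, ← inner_sharp, hv, inner_zero_right]
  have h : ∀ x : M, ∃ a : Fin m → ℝ, (∀ μ, 0 < a μ) ∧ StrictMono a ∧ ∀ z : ℂ,
      (cEnd (sharp β x)).HasEigenvalue z ↔ ∃ μ t, z = eigVal (a μ) t := fun x =>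
    @exists_eigenvalue_pairs (TangentSpace 𝓘(ℝ, E) x) _ _
      (inferInstanceAs (FiniteDimensional ℝ E)) m hdim (sharp β x).toLinearMap
      (fun v w => hβ.sharp_skew v w) (hinj x) (hdist x)
  choose a hpos hmono hev using h
  refine ⟨fun μ x => a x μ, ⟨hpos, hmono, fun x => ?_⟩, hev⟩
  exact @exists_isEigenbasis (TangentSpace 𝓘(ℝ, E) x) _ _ m
    (inferInstanceAs (FiniteDimensional ℝ E)) hdim (sharp β x).toLinearMap (a x) (hpos x)
    (hmono x).injective fun μ t => (hev x _).2 ⟨μ, t, rfl⟩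

namespace EigenSystem

/-- The almost complex structure with `T^{1,0}` the distribution spanned by the eigenvectors
selected by `s`. -/
noncomputable def struct (β : BilinField E M) (a : Fin m → M → ℝ) (s : Fin m → Bool) :
    EndField E M :=
  polyEnd (sharp β) fun x => structPoly (fun μ => a μ x) s

lemma struct_sq (h : EigenSystem (sharp β) a) (s : Fin m → Bool) (x : M)
    (v : TangentSpace 𝓘(ℝ, E) x) :
    struct β a s x (struct β a s x v) = -v := by
  obtain ⟨b, hb⟩ := h.exists_basis x
  rw [struct, polyEnd_apply, polyEnd_apply]
  exact hb.structPoly_sq (h.pos x) (h.injective x) s v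

lemma isOrthogonalEnd_struct (h : EigenSystem (sharp β) a) (s : Fin m → Bool) (hβ : IsTwoForm β) :
    IsOrthogonalEnd (struct β a s) := by
  intro x v w
  obtain ⟨b, hb⟩ := h.exists_basis x
  rw [struct, polyEnd_apply, polyEnd_apply]
  exact hb.inner_structPoly (h.pos x) (h.injective x) (fun v w => hβ.sharp_skew v w) s v w

lemma holTangent_struct (h : EigenSystem (sharp β) a) (s : Fin m → Bool) :
    holTangent (struct β a s) = eigenDistribution β a s := by
  funext x
  obtain ⟨b, hb⟩ := h.exists_basis x
  have h1 := hb.eigenspace_structPoly (h.pos x) (h.injective x) s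
  rw [← toLinearMap_polyEnd (sharp β) (fun x => structPoly (fun μ => a μ x) s) x] at h1
  exact h1

lemma isIsotropic_eigenDistribution (h : EigenSystem (sharp β) a) (s : Fin m → Bool)
    (hβ : IsTwoForm β) :
    IsIsotropic (eigenDistribution β a s) := by
  rw [← h.holTangent_struct s]
  intro x v hv w hw
  exact baseChange_inner_eq_zero (S := (struct β a s x).toLinearMap)
    (h.isOrthogonalEnd_struct s hβ x) hv hw

lemma eigenDistribution_injective (h : EigenSystem (sharp β) a) (x : M) :
    Function.Injective fun s : Fin m → Bool => eigenDistribution β a s x := by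
  obtain ⟨b, hb⟩ := h.exists_basis x
  exact hb.iSup_eigenspace_injective (h.pos x) (h.injective x)

lemma struct_injective (h : EigenSystem (sharp β) a) (x : M) :
    Function.Injective fun s : Fin m → Bool => struct β a s x := by
  intro s t hst
  refine h.eigenDistribution_injective x ?_
  simp only [← h.holTangent_struct, holTangent]
  exact congrArg (fun S => Module.End.eigenspace (cEnd S) Complex.I) hst

end EigenSystem

lemma span_singleton_eq_of_mem {K V : Type*} [Field K] [AddCommGroup V] [Module K V] {v w : V}
    (h : v ∈ Submodule.span K {w}) (hv : v ≠ 0) : Submodule.span K {w} = Submodule.span K {v} := by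
  obtain ⟨c, rfl⟩ := Submodule.mem_span_singleton.1 h
  refine (Submodule.span_singleton_smul_eq (IsUnit.mk0 c ?_) w).symm
  rintro rfl
  exact hv (zero_smul K w)

lemma continuousAt_inner {x : M} {Y Z : VField E M} (hY : CMDiffAt ∞ (T% Y) x)
    (hZ : CMDiffAt ∞ (T% Z) x) : ContinuousAt (fun y => (inner ℝ (Y y) (Z y) : ℝ)) x :=
  (mdifferentiableAt_inner (hY.mdifferentiableAt (by simp))
    (hZ.mdifferentiableAt (by simp))).continuousAt

lemma EigenSystem.isSmoothOfRank_eigenDistribution (h : EigenSystem (sharp β) a)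
    (hβ : IsTwoForm β) (s : Fin m → Bool) : IsSmoothOfRank (eigenDistribution β a s) m := by
  intro x₀
  have hA := hβ.isSmoothEnd_sharp
  have ha := h.contMDiff hA
  obtain ⟨b₀, hb₀⟩ := h.exists_basis x₀
  -- A smooth local frame: extend a vector not killed by the `μ`-th projection at `x₀` and project
  -- it, giving `X μ`, nonzero nearby by continuity. With the imaginary part `∓ (a μ)⁻¹ A (X μ)` it
  -- becomes an eigenvector.
  choose e he using hb₀.exists_projPoly_ne_zero (h.pos x₀) (h.injective x₀)
  choose N hN hNe using fun μ => FiberBundle.exists_contMDiffOn_extend (k := ∞) 𝓘(ℝ, E) E (e μ)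
  set P : Fin m → EndField E M := fun μ =>
    polyEnd (sharp β) fun x => projPoly (fun ν => a ν x) μ with hPdef
  have hP : ∀ μ, IsSmoothEnd (P μ) := isSmoothEnd_projPoly hA h.pos h.injective ha
  set X : Fin m → VField E M := fun μ => (P μ).app (FiberBundle.extend E (e μ)) with hXdef
  set Q : Fin m → EndField E M := fun μ x =>
    (if s μ then -(a μ x)⁻¹ else (a μ x)⁻¹) • sharp β x with hQdef
  have hQ : ∀ μ, IsSmoothEnd (Q μ) := fun μ => by
    refine IsSmoothEnd.smul ?_ hA
    have h1 := (ha μ).inv₀ fun x => (h.pos x μ).ne'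
    cases s μ
    · exact h1
    · exact h1.neg
  have hX₀ : ∀ μ, X μ x₀ ≠ 0 := fun μ => by
    have h1 : X μ x₀ = P μ x₀ (e μ) := by simp [hXdef, EndField.app]
    rw [h1, hPdef, polyEnd_apply]
    exact he μ
  have hne : ∀ᶠ x in nhds x₀, ∀ μ, X μ x ≠ 0 := Filter.eventually_all.2 fun μ => by
    have h1 : CMDiffAt ∞ (T% (X μ)) x₀ := (hP μ).contMDiffAt_app ((hNe μ).contMDiffAt (hN μ))
    filter_upwards [(continuousAt_inner h1 h1).eventually_ne (inner_self_ne_zero.2 (hX₀ μ))]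
      with x hx hx0
    exact hx (by rw [hx0, inner_zero_left])
  obtain ⟨U, hUsub, hUo, hx₀U⟩ := mem_nhds_iff.1 (Filter.inter_mem (Filter.iInter_mem.2 hN) hne)
  have hXs : ∀ μ, ∀ x ∈ U, CMDiffAt ∞ (T% (X μ)) x := fun μ x hx =>
    (hP μ).contMDiffAt_app (((hNe μ).mono fun y hy =>
      Set.mem_iInter.1 (hUsub hy).1 μ).contMDiffAt (hUo.mem_nhds hx))
  refine ⟨U, hUo, hx₀U, X, fun μ => (Q μ).app (X μ), fun μ =>
    ⟨fun x hx => (hXs μ x hx).contMDiffWithinAt,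
      fun x hx => ((hQ μ).contMDiffAt_app (hXs μ x hx)).contMDiffWithinAt⟩, fun x hx => ?_⟩
  obtain ⟨b, hb⟩ := h.exists_basis x
  have hmem : ∀ μ, cvec (X μ x) ((Q μ).app (X μ) x) ∈
      Module.End.eigenspace (cEnd (sharp β x)) (eigVal (a μ x) (s μ)) := fun μ => by
    have h1 := hb.mem_eigenspace_of_projPoly (h.pos x) (h.injective x) μ (s μ)
      (FiberBundle.extend E (e μ) x)
    rw [← polyEnd_apply (sharp β) (fun x => projPoly (fun ν => a ν x) μ) x] at h1
    exact h1
  have hne0 : ∀ μ, cvec (X μ x) ((Q μ).app (X μ) x) ≠ 0 := fun μ h0 =>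
    (hUsub hx).2 μ (one_tmul_add_I_tmul_eq_zero h0).1
  refine ⟨Module.End.eigenvectors_linearIndependent' (cEnd (sharp β x))
    (fun μ => eigVal (a μ x) (s μ)) (fun μ ν hμν => ?_) _ fun μ => ⟨hmem μ, hne0 μ⟩, ?_⟩
  · exact congrArg Prod.fst (eigVal_inj (h.pos x) (h.injective x) (a₁ := (μ, s μ))
      (a₂ := (ν, s ν)) hμν)
  · rw [Submodule.span_range_eq_iSup]
    refine iSup_congr fun μ => ?_
    have h1 := hb.eigenspace_eq (h.pos x) (h.injective x) (μ, s μ)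
    have h2 := hmem μ
    exact ((h1.trans (span_singleton_eq_of_mem (h1 ▸ h2) (hne0 μ)))).symm

/-- The sign is positive because `ω(v, w) = g(Jv, w) = -g(v, Jw)`. -/
lemma sharp_shiftedForm {J : EndField E M} (hJ : IsKaehler J) (σ : M → ℝ) (x : M) :
    sharp (shiftedForm J β σ) x = sharp β x + (σ x / 2) • J x := by
  ext v
  refine ext_inner_left ℝ fun u => ?_
  rw [inner_sharp, _root_.add_apply, _root_.smul_apply, inner_add_right, inner_sharp,
    real_inner_smul_right, shiftedForm, _root_.sub_apply, _root_.sub_apply, _root_.smul_apply,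
    _root_.smul_apply, fundForm_apply, hJ.hermitian.skew hJ.complex.sq, smul_eq_mul]
  ring

/-- The eigenspaces of `sharp β` are complex lines, so `J`, which commutes with it, acts on each of
them by a scalar, and so does the combination `sharp β + (σ/2) J`. -/
lemma EigenSystem.eigenspace_le_shiftedForm (h : EigenSystem (sharp β) a) {J : EndField E M}
    (hJ : IsKaehler J) (hcomm : ∀ x v, sharp β x (J x v) = J x (sharp β x v)) (σ : M → ℝ) (x : M)
    (μ : Fin m) (t : Bool) :
    ∃ z : ℂ, Module.End.eigenspace (cEnd (sharp β x)) (eigVal (a μ x) t) ≤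
      Module.End.eigenspace (cEnd (sharp (shiftedForm J β σ) x)) z := by
  obtain ⟨b, hb⟩ := h.exists_basis x
  have hcomm' : ∀ y, cEnd (sharp β x) (cEnd (J x) y) = cEnd (J x) (cEnd (sharp β x) y) := by
    intro y
    have h1 : (sharp β x).toLinearMap ∘ₗ (J x).toLinearMap =
        (J x).toLinearMap ∘ₗ (sharp β x).toLinearMap := LinearMap.ext (hcomm x)
    have h2 := congrArg (fun f => f.baseChange ℂ y) h1
    simp only [LinearMap.baseChange_comp] at h2
    exact h2
  have hspan := hb.eigenspace_eq (h.pos x) (h.injective x) (μ, t)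
  have hJb : cEnd (J x) (b (μ, t)) ∈
      Module.End.eigenspace (cEnd (sharp β x)) (eigVal (a μ x) t) := by
    rw [Module.End.mem_eigenspace_iff, hcomm']
    exact (congrArg (cEnd (J x)) (hb (μ, t))).trans (map_smul _ _ _)
  obtain ⟨c, hc⟩ := Submodule.mem_span_singleton.1 (hspan.le hJb)
  refine ⟨eigVal (a μ x) t + ((σ x / 2 : ℝ) : ℂ) * c, hspan.le.trans ?_⟩
  rw [Submodule.span_singleton_le_iff_mem, Module.End.mem_eigenspace_iff]
  have h3 : cEnd (sharp (shiftedForm J β σ) x) (b (μ, t)) =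
      cEnd (sharp β x) (b (μ, t)) + (σ x / 2) • cEnd (J x) (b (μ, t)) := by
    rw [sharp_shiftedForm hJ]
    simp [cEnd, LinearMap.baseChange_add, LinearMap.baseChange_smul]
  have h4 : cEnd (sharp β x) (b (μ, t)) = eigVal (a μ x) t • b (μ, t) := hb (μ, t)
  rw [h3, h4, ← hc, add_smul, mul_smul, Complex.coe_smul]
  rfl

end Riemannian

end HamiltonianForms

theorem theorem3 {E : Type*} [NormedAddCommGroup E] [NormedSpace ℝ E] [FiniteDimensional ℝ E]
    {M : Type*} [TopologicalSpace M] [ChartedSpace E M] [IsManifold 𝓘(ℝ, E) ∞ M]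
    [RiemannianBundle (fun x : M => TangentSpace 𝓘(ℝ, E) x)]
    [IsContMDiffRiemannianBundle 𝓘(ℝ, E) ∞ E (fun x : M => TangentSpace 𝓘(ℝ, E) x)]
    (m : ℕ) (hdim : Module.finrank ℝ E = 2 * m)
    (cov : CovariantDerivative 𝓘(ℝ, E) E (fun x : M => TangentSpace 𝓘(ℝ, E) x))
    (hcov : HamiltonianForms.IsLeviCivita cov)
    (J : HamiltonianForms.EndField E M) (hJ : HamiltonianForms.IsKaehler J)
    (ψ : HamiltonianForms.BilinField E M) (σ : M → ℝ)
    (hψ : HamiltonianForms.IsHamiltonian cov J ψ σ)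
    (hnd : HamiltonianForms.IsNondegenerate ψ)
    (hdist : HamiltonianForms.HasDistinctEigenvalues ψ) :
    -- the eigenvalues are `± i a μ` with `0 < a 0 < a 1 < ...` smooth
    (∃ a : Fin m → M → ℝ,
      (∀ μ, ContMDiff 𝓘(ℝ, E) 𝓘(ℝ, ℝ) ∞ (a μ)) ∧
      (∀ x μ, 0 < a μ x) ∧
      (∀ x, StrictMono fun μ => a μ x) ∧
      (∀ x (z : ℂ), (HamiltonianForms.cEnd (HamiltonianForms.sharp ψ x)).HasEigenvalue z ↔
        ∃ μ, z = (a μ x : ℂ) * Complex.I ∨ z = -((a μ x : ℂ) * Complex.I)) ∧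
      -- the `2 ^ m` associated distributions are distinct, maximal isotropic and integrable
      (∀ s : Fin m → Bool,
        HamiltonianForms.IsSmoothOfRank (HamiltonianForms.eigenDistribution ψ a s) m ∧
        HamiltonianForms.IsIsotropic (HamiltonianForms.eigenDistribution ψ a s) ∧
        HamiltonianForms.IsInvolutive (HamiltonianForms.eigenDistribution ψ a s)) ∧
      (∀ x, Function.Injective
        fun s : Fin m → Bool => HamiltonianForms.eigenDistribution ψ a s x) ∧
      -- and they define `2 ^ m` distinct complex structures, for which the metric is Hermitian
      (∃ 𝒥 : (Fin m → Bool) → HamiltonianForms.EndField E M,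
        (∀ s, HamiltonianForms.IsComplexStructure (𝒥 s) ∧
          HamiltonianForms.IsOrthogonalEnd (𝒥 s) ∧
          HamiltonianForms.holTangent (𝒥 s) = HamiltonianForms.eigenDistribution ψ a s) ∧
        (∀ x, Function.Injective fun s : Fin m → Bool => 𝒥 s x))) ∧
    -- `φ = ψ - σ ω / 2` is a conformal Killing-Yano tensor, the eigenvectors of `ψ` are
    -- eigenvectors of `φ`, and `φ` is not closed unless it is parallel (`2 ≤ m`)
    HamiltonianForms.IsConformalKilling cov (HamiltonianForms.shiftedForm J ψ σ) ∧
    (∀ x (z : ℂ), (HamiltonianForms.cEnd (HamiltonianForms.sharp ψ x)).HasEigenvalue z →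
      ∃ z' : ℂ, Module.End.eigenspace (HamiltonianForms.cEnd (HamiltonianForms.sharp ψ x)) z ≤
        Module.End.eigenspace (HamiltonianForms.cEnd
          (HamiltonianForms.sharp (HamiltonianForms.shiftedForm J ψ σ) x)) z') ∧
    (2 ≤ m → (HamiltonianForms.IsClosedForm (HamiltonianForms.shiftedForm J ψ σ) ↔
      HamiltonianForms.IsParallelForm cov (HamiltonianForms.shiftedForm J ψ σ))) := by
  have hA := hψ.form.isSmoothEnd_sharp
  have hcomm := hψ.sharp_comm hJ.complex.sq hJ.hermitian
  obtain ⟨a, ha, hev⟩ := hψ.form.exists_eigenSystem hdim hnd hdist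
  have hcs : ∀ s, HamiltonianForms.IsComplexStructure
      (HamiltonianForms.EigenSystem.struct ψ a s) := fun s =>
    hψ.isComplexStructure_of_aeval hcov hJ.complex.sq hJ.hermitian
      (HamiltonianForms.isSmoothEnd_structPoly hA ha.pos ha.injective (ha.contMDiff hA) s)
      (ha.struct_sq s) (ha.isOrthogonalEnd_struct s hψ.form) _
      (HamiltonianForms.polyEnd_apply _ _)
  refine ⟨⟨a, ha.contMDiff hA, ha.pos, ha.strictMono, fun x z => ?_, fun s =>
      ⟨ha.isSmoothOfRank_eigenDistribution hψ.form s, ha.isIsotropic_eigenDistribution s hψ.form,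
        ha.holTangent_struct s ▸ (hcs s).isInvolutive_holTangent⟩, ha.eigenDistribution_injective,
      HamiltonianForms.EigenSystem.struct ψ a, fun s =>
        ⟨hcs s, ha.isOrthogonalEnd_struct s hψ.form, ha.holTangent_struct s⟩,
      ha.struct_injective⟩,
    hψ.isConformalKilling_shiftedForm hdim hcov hJ, fun x z hz => ?_,
    fun hm => hψ.isClosedForm_shiftedForm_iff hdim hm hcov hJ⟩
  · rw [hev]
    refine exists_congr fun μ => ?_
    simp [HamiltonianForms.eigVal, or_comm]
  · obtain ⟨μ, t, rfl⟩ := (hev x z).1 hz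
    exact ha.eigenspace_le_shiftedForm hJ hcomm σ x μ t
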